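/- Fix $\sigma>0$. For each $n\ge 1$, on some probability space, let $u^0=(u^0_i)_{i\le n}$ be a random vector in $\mathbb{R}^n$ and $Z=(z_{ii'})$ a random symmetric $n\times n$ matrix (possibly dependent on each other) such that, for a constant $C$ independent of $n$, $$\mathbb{E}\exp\Bigl(\frac{\|u^0\|_2^2}{\sigma n}\Bigr)\le C,\qquad \max_{i}\mathbb{E}\exp\Bigl(\frac{|u^0_i|}{\sigma}\Bigr)\le C,\qquad \max_{i,i'}\mathbb{E}\exp\Bigl(\frac{|z_{ii'}|}{\sigma}\Bigr)\le C .$$ Let $G$ be a random symmetric $n\times n$ matrix, independent of $(u^0,Z)$, whose entries on and above the diagonal are independent standard normal variables. For every $k\ge 0$ let $F_k:\mathbb{R}^{k+1}\to\mathbb{R}$ be a Lipschitz function not depending on $n$. For a symmetric $n\times n$ matrix $X$ put $\hat X_n=X/\sqrt n+Z/n$ and define the generalized AMP orbit by $u^{[0]}(X)=u^0$ and, for $k\ge 0$ and $1\le i\le n$, $$u^{[k+1]}_i(X)=F_k\bigl((\hat X_n u^{[k]}(X))_i,\,u^{[k-1]}_i(X),\ldots,u^{[0]}_i(X)\bigr).$$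 Then for every $k\ge 0$ and every Lipschitz function $\phi:\mathbb{R}^{k+1}\to\mathbb{R}$ (not depending on $n$), the average $$\Phi_{k,n}(X)=\frac1n\sum_{i=1}^n\phi\bigl(u^{[k]}_i(X),\ldots,u^{[0]}_i(X)\bigr)$$ is such that $\Phi_{k,n}(G)$ is square-integrable for every $n\ge 1$ and $$\lim_{n\to\infty}\mathbb{E}\bigl|\Phi_{k,n}(G)-\mathbb{E}[\Phi_{k,n}(G)\mid u^0,Z]\bigr|^2=0 .$$ -/

import Mathlib

open MeasureTheory ProbabilityTheory Filter Topology

noncomputable section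

/-- The product (= Borel) σ-algebra on real matrices. -/
instance instMeasurableSpaceRealMatrix {n : ℕ} : MeasurableSpace (Matrix (Fin n) (Fin n) ℝ) :=
  inferInstanceAs (MeasurableSpace (Fin n → Fin n → ℝ))

/-- The matrix `X / √n + Z / n`. -/
def hatMatrix {n : ℕ} (X Z : Matrix (Fin n) (Fin n) ℝ) : Matrix (Fin n) (Fin n) ℝ :=
  (Real.sqrt (n : ℝ))⁻¹ • X + ((n : ℝ))⁻¹ • Z

/-- The generalized AMP orbit of `(X, Z)`, `(F k)` and the initialization `init`: coordinatewise,
`u^[k+1](X) = F k (X̂ u^[k](X), u^[k-1](X), …, u^[0](X))`. -/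
def ampOrbit {n : ℕ} (F : (k : ℕ) → (Fin (k + 1) → ℝ) → ℝ) (Z : Matrix (Fin n) (Fin n) ℝ)
    (init : Matrix (Fin n) (Fin n) ℝ → Fin n → ℝ) :
    ℕ → Matrix (Fin n) (Fin n) ℝ → Fin n → ℝ
  | 0, X => init X
  | k + 1, X => fun i =>
      F k (Fin.cons (Matrix.mulVec (hatMatrix X Z) (ampOrbit F Z init k X) i)
        (fun j : Fin k => ampOrbit F Z init (k - 1 - (j : ℕ)) X i))
  termination_by k => k
  decreasing_by all_goals omega

/-- The average `(1/n) ∑ i, φ (u_i^[k](X), …, u_i^[0](X))` along the AMP orbit. -/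
def ampAverage {n : ℕ} (F : (k : ℕ) → (Fin (k + 1) → ℝ) → ℝ) (Z : Matrix (Fin n) (Fin n) ℝ)
    (init : Matrix (Fin n) (Fin n) ℝ → Fin n → ℝ) (k : ℕ) (φ : (Fin (k + 1) → ℝ) → ℝ)
    (X : Matrix (Fin n) (Fin n) ℝ) : ℝ :=
  (n : ℝ)⁻¹ * ∑ i : Fin n, φ (fun j : Fin (k + 1) => ampOrbit F Z init (k - (j : ℕ)) X i)

/-- The random variable `Φ_{k,n}(G)` for the orbit with the initialization `u^[0](X) = u0`. -/
def randomAverage {Ω : Type*} {n : ℕ} (F : (k : ℕ) → (Fin (k + 1) → ℝ) → ℝ)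
    (k : ℕ) (φ : (Fin (k + 1) → ℝ) → ℝ) (u0 : Ω → Fin n → ℝ)
    (Z G : Ω → Matrix (Fin n) (Fin n) ℝ) (ω : Ω) : ℝ :=
  ampAverage F (Z ω) (fun _ => u0 ω) k φ (G ω)

/-- `G` is a random symmetric matrix whose entries on and above the diagonal are independent
standard normal variables. -/
structure IsGaussianSymm {Ω : Type*} [MeasurableSpace Ω] (P : Measure Ω) {n : ℕ}
    (G : Ω → Matrix (Fin n) (Fin n) ℝ) : Prop where
  measurable : Measurable G
  symm : ∀ ω, (G ω).IsSymm
  law : ∀ i j : Fin n, i ≤ j → P.map (fun ω => G ω i j) = gaussianReal 0 1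
  indep : iIndepFun
    (fun (p : {p : Fin n × Fin n // p.1 ≤ p.2}) (ω : Ω) => G ω p.1.1 p.1.2) P

end

noncomputable section

/-! ### Absolute continuity of the standard Gaussian measure -/

/-! Freeze `(u^0, Z)` and view the average as a function of the upper triangular entries of `G`, a
standard Gaussian vector `x`. The theorem then says that the variance of this function, averaged
over `(u^0, Z)`, tends to `0`; the bound obtained is `O(1/n)`.

The rate comes from the Gaussian Poincaré inequality `gaussian_poincare`. Each AMP step is one
multiplication by `X̂` followed by a Lipschitz map, so `k` steps have growth and Lipschitz constants
of order `S^k U`, where `S ≥ 1` bounds the operator norm of `X̂` and `U ≥ 1` bounds `‖u^0‖/√n`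
(`exists_ampOrbit_bound`). Averaging over `n` coordinates gains a factor `1/√n` by Cauchy–Schwarz
(`exists_ampAverage_bound`). The squared local Lipschitz constant is therefore `S^(2k) U^2 / n` up
to a constant.

It remains to bound the mean of `S^(2k) U^2` uniformly in `n`. The operator norm of `X̂` is at most
a product of a Gaussian size and a size of `Z`. The former has bounded moments by a net argument
(`lintegral_opNorm_div_sqrt_pow_le`); the latter and `U` are handled by the exponential moment
hypotheses (`lintegral_size_le`).

The passage from frozen `(u^0, Z)` to the conditional expectation is
`integral_sq_sub_condExp_le_of_map_eq_prod`. -/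

lemma MeasureTheory.Measure.AbsolutelyContinuous.pi_fin {n : ℕ} {X : Fin n → Type*}
    [∀ i, MeasurableSpace (X i)] {μ ν : (i : Fin n) → Measure (X i)} [∀ i, SigmaFinite (μ i)]
    [∀ i, SigmaFinite (ν i)] (h : ∀ i, μ i ≪ ν i) : Measure.pi μ ≪ Measure.pi ν := by
  induction n with
  | zero => rw [Measure.pi_of_empty, Measure.pi_of_empty]
  | succ n ih =>
    rw [← ((measurePreserving_piFinSuccAbove μ 0).symm).map_eq,
      ← ((measurePreserving_piFinSuccAbove ν 0).symm).map_eq]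
    exact ((h 0).prod (ih fun i => h _)).map (MeasurableEquiv.measurable _)

/-! ### Locally Lipschitz functions and the Gaussian Poincaré inequality -/

lemma continuous_of_locally_lipschitz {E : Type*} [NormedAddCommGroup E] {f b : E → ℝ}
    (hb : Continuous b) (hfb : ∀ x y, |f x - f y| ≤ (b x + b y) * ‖x - y‖) : Continuous f := by
  refine continuous_iff_continuousAt.2 fun x => ?_
  rw [ContinuousAt, tendsto_iff_dist_tendsto_zero]
  refine squeeze_zero (fun _ => dist_nonneg) (fun y => (Real.dist_eq _ _).trans_le (hfb y x)) ?_
  have h : Continuous fun y => (b y + b x) * ‖y - x‖ := by fun_prop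
  simpa using h.tendsto x

lemma norm_fderiv_le_of_locally_lipschitz {E : Type*} [NormedAddCommGroup E]
    [NormedSpace ℝ E] {f b : E → ℝ} (hb : Continuous b) (hb0 : ∀ x, 0 ≤ b x)
    (hfb : ∀ x y, |f x - f y| ≤ (b x + b y) * ‖x - y‖) (x : E) :
    ‖fderiv ℝ f x‖ ≤ 2 * b x := by
  refine le_of_forall_pos_le_add fun ε hε => ?_
  refine norm_fderiv_le_of_lip' ℝ (by have := hb0 x; positivity) ?_
  have hev : ∀ᶠ y in 𝓝 x, b y < b x + ε :=
    hb.continuousAt.eventually (gt_mem_nhds (by linarith))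
  filter_upwards [hev] with y hy
  rw [Real.norm_eq_abs]
  refine (hfb y x).trans (mul_le_mul_of_nonneg_right ?_ (norm_nonneg _))
  linarith

section Poincare

variable {E : Type*} [NormedAddCommGroup E] [InnerProductSpace ℝ E] [FiniteDimensional ℝ E]
  [MeasurableSpace E] [BorelSpace E]

/-- Needed to carry Rademacher's theorem from Lebesgue measure to the Gaussian. -/
lemma stdGaussian_absolutelyContinuous : stdGaussian E ≪ (volume : Measure E) := by
  have hv : (volume : Measure E) =
      (volume : Measure (Fin (Module.finrank ℝ E) → ℝ)).map
        (fun x ↦ ∑ i, x i • stdOrthonormalBasis ℝ E i) := by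
    rw [← ((stdOrthonormalBasis ℝ E).measurePreserving_repr_symm.comp
      (PiLp.volume_preserving_toLp _)).map_eq]
    congr 1
    ext x
    simp [OrthonormalBasis.sum_repr_symm]
  rw [hv, stdGaussian]
  refine Measure.AbsolutelyContinuous.map ?_ (by fun_prop)
  rw [volume_pi]
  exact Measure.AbsolutelyContinuous.pi_fin
    fun i => gaussianReal_absolutelyContinuous 0 one_ne_zero

lemma stdGaussian_map_rotation (θ : ℝ) :
    ((stdGaussian E).prod (stdGaussian E)).map (ContinuousLinearMap.rotation θ) =
      (stdGaussian E).prod (stdGaussian E) :=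
  IsGaussian.map_rotation_eq_self_of_forall_strongDual_eq_zero
    (fun L => integral_strongDual_stdGaussian L) θ

/-- Subdividing the quarter turn from `x` to `y` into `m` equal rotations. -/
lemma lintegral_sq_sub_le_rotation {f : E → ℝ} (hf : Continuous f) {m : ℕ} (hm : m ≠ 0) :
    ∫⁻ p, ENNReal.ofReal ((f p.1 - f p.2) ^ 2) ∂((stdGaussian E).prod (stdGaussian E)) ≤
      ∫⁻ p, ENNReal.ofReal ((m * (f p.1 - f (Real.cos (Real.pi / 2 / m) • p.1 +
        Real.sin (Real.pi / 2 / m) • p.2))) ^ 2) ∂((stdGaussian E).prod (stdGaussian E)) := by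
  set γ := (stdGaussian E).prod (stdGaussian E)
  set δ := Real.pi / 2 / m with hδ
  have hm0 : (m : ℝ) ≠ 0 := by exact_mod_cast hm
  set D : E × E → ℝ := fun p => f p.1 - f (Real.cos δ • p.1 + Real.sin δ • p.2) with hD
  have hDc : Continuous D := by fun_prop
  -- By the angle addition formulas, `D` at the rotated pair is the `j`-th increment of `f` along
  -- the arc from `p.1` to `p.2`.
  have hstep : ∀ (j : ℕ) (p : E × E), D (ContinuousLinearMap.rotation (j * δ) p) =
      f (Real.cos (j * δ) • p.1 + Real.sin (j * δ) • p.2) -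
      f (Real.cos ((j + 1 : ℕ) * δ) • p.1 + Real.sin ((j + 1 : ℕ) * δ) • p.2) := by
    intro j p
    simp only [hD, ContinuousLinearMap.rotation_apply]
    congr 2
    push_cast
    rw [add_mul, one_mul, Real.cos_add, Real.sin_add]
    module
  have htel : ∀ p : E × E, f p.1 - f p.2 =
      ∑ j ∈ Finset.range m, D (ContinuousLinearMap.rotation (j * δ) p) := by
    intro p
    simp_rw [hstep]
    rw [Finset.sum_range_sub' (fun j : ℕ =>
      f (Real.cos (j * δ) • p.1 + Real.sin (j * δ) • p.2))]
    have : (m : ℝ) * δ = Real.pi / 2 := by rw [hδ]; field_simp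
    simp [this]
  have hpt : ∀ p : E × E, ENNReal.ofReal ((f p.1 - f p.2) ^ 2) ≤
      ∑ j ∈ Finset.range m,
        ENNReal.ofReal (m * D (ContinuousLinearMap.rotation (j * δ) p) ^ 2) := by
    intro p
    rw [← ENNReal.ofReal_sum_of_nonneg (fun _ _ => by positivity)]
    apply ENNReal.ofReal_le_ofReal
    -- Cauchy–Schwarz over `m` increments costs one factor `m`. By rotation invariance they all have
    -- the same law, so summing them gives the second.
    rw [htel, ← Finset.mul_sum]
    simpa using sq_sum_le_card_mul_sum_sq (s := Finset.range m)
      (f := fun j : ℕ => D (ContinuousLinearMap.rotation (j * δ) p))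
  calc _ ≤ ∫⁻ p, ∑ j ∈ Finset.range m,
        ENNReal.ofReal (m * D (ContinuousLinearMap.rotation (j * δ) p) ^ 2) ∂γ :=
        lintegral_mono hpt
    _ = ∑ j ∈ Finset.range m, ∫⁻ p,
        ENNReal.ofReal (m * D (ContinuousLinearMap.rotation (j * δ) p) ^ 2) ∂γ :=
        lintegral_finsetSum _ fun j _ => by
          have := hDc.measurable
          fun_prop
    _ = ∑ j ∈ Finset.range m, ∫⁻ p, ENNReal.ofReal (m * D p ^ 2) ∂γ := by
        refine Finset.sum_congr rfl fun j _ => ?_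
        have hγ : γ = γ.map (ContinuousLinearMap.rotation (j * δ)) :=
          (stdGaussian_map_rotation (j * δ)).symm
        conv_rhs => rw [hγ]
        rw [lintegral_map (by have := hDc.measurable; fun_prop) (by fun_prop)]
    _ = _ := by
        rw [Finset.sum_const, Finset.card_range, nsmul_eq_mul,
          ← lintegral_const_mul _ (by have := hDc.measurable; fun_prop)]
        refine lintegral_congr fun p => ?_
        rw [← ENNReal.ofReal_natCast, ← ENNReal.ofReal_mul (by positivity)]
        congr 1
        simp only [hD]
        ring

lemma integrable_one_add_norm_pow_stdGaussian_prod (q : ℕ) :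
    Integrable (fun p : E × E => (1 + ‖p.1‖ + ‖p.2‖) ^ q)
      ((stdGaussian E).prod (stdGaussian E)) := by
  have h : MemLp (fun p : E × E => 1 + ‖p.1‖ + ‖p.2‖) q
      ((stdGaussian E).prod (stdGaussian E)) := by
    have h1 : MemLp (fun p : E × E => p.1) q ((stdGaussian E).prod (stdGaussian E)) :=
      (IsGaussian.memLp_id (stdGaussian E) q (by simp)).comp_fst _
    have h2 : MemLp (fun p : E × E => p.2) q ((stdGaussian E).prod (stdGaussian E)) :=
      (IsGaussian.memLp_id (stdGaussian E) q (by simp)).comp_snd _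
    have h0 : MemLp (fun _ : E × E => (1 : ℝ)) q ((stdGaussian E).prod (stdGaussian E)) :=
      memLp_const 1
    have h01 := h0.add h1.norm
    exact h01.add h2.norm
  refine h.integrable_norm_pow'.congr (ae_of_all _ fun p => ?_)
  simp only [Real.norm_eq_abs]
  rw [abs_of_nonneg (by positivity)]

lemma lintegral_sq_dual_stdGaussian (L : StrongDual ℝ E) :
    ∫⁻ y, ENNReal.ofReal (L y ^ 2) ∂(stdGaussian E) = ENNReal.ofReal (‖L‖ ^ 2) := by
  have hL : MemLp L 2 (stdGaussian E) := IsGaussian.memLp_dual _ _ _ (by simp)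
  rw [← variance_dual_stdGaussian, variance_of_integral_eq_zero (by fun_prop)
    (integral_strongDual_stdGaussian L), ofReal_integral_eq_lintegral_ofReal hL.integrable_sq
    (ae_of_all _ fun _ => by positivity)]

variable {f b : E → ℝ} {C : ℝ} {q : ℕ}

/-- Rademacher's theorem on each ball of integer radius, where `b` is bounded by compactness. -/
lemma ae_differentiableAt_stdGaussian_of_locally_lipschitz
    (hb : Continuous b) (hfb : ∀ x y, |f x - f y| ≤ (b x + b y) * ‖x - y‖) :
    ∀ᵐ x ∂(stdGaussian E), DifferentiableAt ℝ f x := by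
  refine stdGaussian_absolutelyContinuous.ae_le ?_
  have hR : ∀ R : ℕ, ∀ᵐ x : E, x ∈ Metric.ball (0 : E) R →
      DifferentiableWithinAt ℝ f (Metric.ball (0 : E) R) x := by
    intro R
    obtain ⟨K, hK⟩ := (isCompact_closedBall (0 : E) R).exists_bound_of_continuousOn
      hb.continuousOn
    have hlip : LipschitzOnWith (2 * K).toNNReal f (Metric.ball (0 : E) R) := by
      refine LipschitzOnWith.of_dist_le_mul fun x hx y hy => ?_
      rw [Real.dist_eq, dist_eq_norm]
      refine (hfb x y).trans ?_
      gcongr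
      refine le_trans ?_ (Real.le_coe_toNNReal _)
      have h1 := (abs_le.1 (hK x (Metric.ball_subset_closedBall hx))).2
      have h2 := (abs_le.1 (hK y (Metric.ball_subset_closedBall hy))).2
      linarith
    exact hlip.ae_differentiableWithinAt_of_mem
  filter_upwards [ae_all_iff.2 hR] with x hx
  obtain ⟨R, hxR⟩ := exists_nat_gt ‖x‖
  have hmem : x ∈ Metric.ball (0 : E) R := by simpa using hxR
  exact (hx R hmem).differentiableAt (Metric.isOpen_ball.mem_nhds hmem)

/-- **Gaussian Poincaré inequality**, in symmetrized form, for a locally Lipschitz function with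
local Lipschitz constants of polynomial growth. -/
theorem gaussian_poincare (hb : Continuous b) (hb0 : ∀ x, 0 ≤ b x)
    (hC : ∀ x, b x ≤ C * (1 + ‖x‖) ^ q)
    (hfb : ∀ x y, |f x - f y| ≤ (b x + b y) * ‖x - y‖) :
    ∫⁻ p, ENNReal.ofReal ((f p.1 - f p.2) ^ 2) ∂((stdGaussian E).prod (stdGaussian E)) ≤
      ENNReal.ofReal (Real.pi ^ 2) * ∫⁻ x, ENNReal.ofReal (b x ^ 2) ∂(stdGaussian E) := by
  have hf := continuous_of_locally_lipschitz hb hfb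
  have hC0 : 0 ≤ C := by simpa using (hb0 0).trans (hC 0)
  -- As the angle `(π/2)/(m+1)` shrinks, the rescaled increment becomes, up to sign, `π/2` times the
  -- derivative of `f` at `p.1` in the independent Gaussian direction `p.2`.
  have hlim : Tendsto (fun m : ℕ => ∫⁻ p, ENNReal.ofReal (((m + 1 : ℕ) * (f p.1 -
        f (Real.cos (Real.pi / 2 / (m + 1 : ℕ)) • p.1 +
        Real.sin (Real.pi / 2 / (m + 1 : ℕ)) • p.2))) ^ 2)
        ∂((stdGaussian E).prod (stdGaussian E))) atTop
      (𝓝 (∫⁻ p, ENNReal.ofReal ((Real.pi / 2 * fderiv ℝ f p.1 p.2) ^ 2)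
        ∂((stdGaussian E).prod (stdGaussian E)))) := by
    refine tendsto_lintegral_of_dominated_convergence
      (fun p => ENNReal.ofReal ((Real.pi * C) ^ 2 * (1 + ‖p.1‖ + ‖p.2‖) ^ (2 * (q + 1))))
      (fun m => ?_) (fun m => ae_of_all _ fun p => ?_) ?_ ?_
    · have := hf.measurable
      fun_prop
    · apply ENNReal.ofReal_le_ofReal
      obtain ⟨x, y⟩ := p
      simp only
      set M : ℝ := ((m + 1 : ℕ) : ℝ)
      have hM : 0 < M := by positivity
      set δ := Real.pi / 2 / M with hδ
      have hδ0 : 0 ≤ δ := by positivity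
      set z := Real.cos δ • x + Real.sin δ • y with hz
      set S := 1 + ‖x‖ + ‖y‖ with hS
      have hS1 : 1 ≤ S := by rw [hS]; linarith [norm_nonneg x, norm_nonneg y]
      have hzn : 1 + ‖z‖ ≤ S := by
        have : ‖z‖ ≤ 1 * ‖x‖ + 1 * ‖y‖ := by
          refine (norm_add_le _ _).trans ?_
          rw [norm_smul, norm_smul]
          gcongr
          · exact Real.abs_cos_le_one δ
          · exact Real.abs_sin_le_one δ
        rw [hS]; linarith
      have hxz : ‖x - z‖ ≤ δ * S := by
        have h1 : x - z = (1 - Real.cos δ) • x - Real.sin δ • y := by rw [hz]; module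
        -- From `1 - cos δ ≤ δ²/2`, which is at most `δ` because `δ ≤ π/2 ≤ 2`.
        have h2 : |1 - Real.cos δ| ≤ δ := by
          have hp := Real.pi_le_four
          have hM1 : 1 ≤ M := by simp [M]
          have hδ2 : δ ≤ 2 := by
            rw [hδ]
            refine (div_le_self (by positivity) hM1).trans (by linarith)
          rw [abs_of_nonneg (by linarith [Real.cos_le_one δ])]
          have := Real.one_sub_sq_div_two_le_cos (x := δ)
          nlinarith
        have h3 : |Real.sin δ| ≤ δ := by
          simpa [abs_of_nonneg hδ0] using Real.abs_sin_le_abs (x := δ)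
        rw [h1]
        calc _ ≤ ‖(1 - Real.cos δ) • x‖ + ‖Real.sin δ • y‖ := norm_sub_le _ _
          _ ≤ δ * ‖x‖ + δ * ‖y‖ := by
            rw [norm_smul, norm_smul]
            gcongr
            · exact h2
            · exact h3
          _ ≤ δ * S := by rw [hS]; nlinarith
      have hbx : b x ≤ C * S ^ q := (hC x).trans (by
        gcongr
        rw [hS]; linarith [norm_nonneg y])
      have hbz : b z ≤ C * S ^ q := (hC z).trans (by gcongr)
      have hbd : |M * (f x - f z)| ≤ Real.pi * C * S ^ (q + 1) := by
        rw [abs_mul, abs_of_pos hM]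
        calc M * |f x - f z| ≤ M * ((b x + b z) * ‖x - z‖) := by gcongr; exact hfb x z
          _ ≤ M * ((C * S ^ q + C * S ^ q) * (δ * S)) := by
            have := hb0 x
            have := hb0 z
            gcongr
          _ = (M * δ * 2) * C * S ^ (q + 1) := by ring
          _ = _ := by rw [hδ]; field_simp
      calc _ = |M * (f x - f z)| ^ 2 := (sq_abs _).symm
        _ ≤ (Real.pi * C * S ^ (q + 1)) ^ 2 := by gcongr
        _ = _ := by ring
    · exact ((integrable_one_add_norm_pow_stdGaussian_prod _).const_mul _).lintegral_lt_top.ne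
    · have hd := ae_differentiableAt_stdGaussian_of_locally_lipschitz hb hfb
      filter_upwards [Measure.quasiMeasurePreserving_fst.ae hd] with p hp
      obtain ⟨x, y⟩ := p
      simp only at hp ⊢
      refine (ENNReal.continuous_ofReal.tendsto _).comp ?_
      have hpath : HasDerivAt (fun t : ℝ => Real.cos t • x + Real.sin t • y) y 0 := by
        have h1 := ((Real.hasDerivAt_cos 0).smul_const x).add
          ((Real.hasDerivAt_sin 0).smul_const y)
        rw [Real.sin_zero, Real.cos_zero, neg_zero, zero_smul, one_smul, zero_add] at h1
        exact h1
      have hcomp : HasDerivAt (fun t : ℝ => f (Real.cos t • x + Real.sin t • y))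
          (fderiv ℝ f x y) 0 := by
        have hx : HasFDerivAt f (fderiv ℝ f x) (Real.cos 0 • x + Real.sin 0 • y) := by
          simpa using hp.hasFDerivAt
        exact hx.comp_hasDerivAt 0 hpath
      have hseq : Tendsto (fun m : ℕ => Real.pi / 2 / ((m + 1 : ℕ) : ℝ)) atTop (𝓝[≠] 0) := by
        refine tendsto_nhdsWithin_iff.2 ⟨?_, ?_⟩
        · exact (tendsto_const_div_atTop_nhds_zero_nat (Real.pi / 2)).comp (tendsto_add_atTop_nat 1)
        · filter_upwards with m
          have : 0 < Real.pi / 2 / ((m + 1 : ℕ) : ℝ) := by positivity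
          exact this.ne'
      have hs := (hcomp.tendsto_slope.comp hseq).const_mul (Real.pi / 2)
      have hs2 := hs.pow 2
      refine hs2.congr fun m => ?_
      have hm : ((m + 1 : ℕ) : ℝ) ≠ 0 := by positivity
      simp only [Function.comp_apply, slope_def_field, Real.cos_zero, Real.sin_zero, one_smul,
        zero_smul, add_zero, sub_zero]
      have hpi := Real.pi_ne_zero
      field_simp
      ring
  -- The left side does not depend on `m`, so it is bounded by the limit. Given `x`, the derivative
  -- in a Gaussian direction has second moment `‖fderiv ℝ f x‖²`; with `‖fderiv ℝ f x‖ ≤ 2 b x` the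
  -- constant is `(π/2)² · 4 = π²`.
  refine (ge_of_tendsto hlim (Eventually.of_forall fun m =>
    lintegral_sq_sub_le_rotation hf m.succ_ne_zero)).trans ?_
  refine (lintegral_prod_le _).trans ?_
  rw [← lintegral_const_mul _ (by have := hb.measurable; fun_prop)]
  refine lintegral_mono fun x => ?_
  have h1 : ∀ y, ENNReal.ofReal ((Real.pi / 2 * fderiv ℝ f x y) ^ 2) =
      ENNReal.ofReal ((Real.pi / 2) ^ 2) * ENNReal.ofReal (fderiv ℝ f x y ^ 2) := fun y => by
    rw [← ENNReal.ofReal_mul (by positivity), mul_pow]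
  simp only [h1]
  rw [lintegral_const_mul _ (by fun_prop), lintegral_sq_dual_stdGaussian,
    ← ENNReal.ofReal_mul (by positivity), ← ENNReal.ofReal_mul (by positivity)]
  apply ENNReal.ofReal_le_ofReal
  have h2 := norm_fderiv_le_of_locally_lipschitz hb hb0 hfb x
  calc _ ≤ (Real.pi / 2) ^ 2 * (2 * b x) ^ 2 := by gcongr
    _ = _ := by ring

end Poincare

/-! ### Exponential moments of the operator norm of a Gaussian operator -/

section Net

variable {H K : Type*} [NormedAddCommGroup H] [InnerProductSpace ℝ H]
  [NormedAddCommGroup K] [NormedSpace ℝ K]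

variable (H) in
/-- A `1`-net of the ball of radius `2` with at most `5 ^ dim` points. -/
lemma exists_finset_net [FiniteDimensional ℝ H] : ∃ s : Finset H, s.card ≤ 5 ^ Module.finrank ℝ H ∧
    (∀ c ∈ s, ‖c‖ ≤ 2) ∧ ∀ v : H, ‖v‖ ≤ 2 → ∃ c ∈ s, ‖v - c‖ ≤ 1 := by
  classical
  -- A `1`-separated set of largest cardinality is a net: a point far from it could be added. The
  -- volume bound `Besicovitch.card_le_of_separated` limits its size.
  let Q : ℕ → Prop := fun m => ∃ s : Finset H, s.card = m ∧ (∀ c ∈ s, ‖c‖ ≤ 2) ∧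
    ∀ c ∈ s, ∀ d ∈ s, c ≠ d → 1 ≤ ‖c - d‖
  have hQ0 : Q 0 := ⟨∅, by simp⟩
  obtain ⟨s, hcard, hs2, hsep⟩ : Q (Nat.findGreatest Q (5 ^ Module.finrank ℝ H)) :=
    Nat.findGreatest_spec (Nat.zero_le _) hQ0
  refine ⟨s, hcard ▸ Nat.findGreatest_le _, hs2, fun v hv => ?_⟩
  by_contra! hfar
  have hvs : v ∉ s := fun h => by simpa using (hfar v h).trans' zero_lt_one
  have hins : Q (s.card + 1) := by
    refine ⟨insert v s, Finset.card_insert_of_notMem hvs, ?_, ?_⟩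
    · simpa using ⟨hv, hs2⟩
    · intro c hc d hd hcd
      rcases Finset.mem_insert.1 hc with hcv | hc <;>
        rcases Finset.mem_insert.1 hd with hdv | hd
      · exact absurd (hcv.trans hdv.symm) hcd
      · rw [hcv]; exact (hfar d hd).le
      · rw [hdv, norm_sub_rev]; exact (hfar c hc).le
      · exact hsep c hc d hd hcd
  have hle : s.card + 1 ≤ 5 ^ Module.finrank ℝ H := by
    obtain ⟨t, ht, ht2, htsep⟩ := hins
    rw [← ht]
    exact Besicovitch.card_le_of_separated t ht2 htsep
  have := Nat.le_findGreatest hle hins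
  omega

/-- Approximating `2u`, for a unit vector `u`, gives `2‖A u‖ ≤ M + ‖A‖`, and the error `‖A‖` is
absorbed in the left side. -/
lemma opNorm_le_of_net {s : Finset H} (hs : ∀ v : H, ‖v‖ ≤ 2 → ∃ c ∈ s, ‖v - c‖ ≤ 1)
    (A : H →L[ℝ] K) {M : ℝ} (hM : ∀ c ∈ s, ‖A c‖ ≤ M) : ‖A‖ ≤ M := by
  have hM0 : 0 ≤ M := by
    obtain ⟨c, hc, -⟩ := hs 0 (by simp)
    exact (norm_nonneg _).trans (hM c hc)
  have h : ‖A‖ ≤ (M + ‖A‖) / 2 := by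
    refine A.opNorm_le_of_unit_norm (by positivity) fun u hu => ?_
    obtain ⟨c, hc, huc⟩ := hs ((2 : ℝ) • u) (by simp [norm_smul, hu])
    have h1 : (2 : ℝ) * ‖A u‖ ≤ M + ‖A‖ := by
      calc (2 : ℝ) * ‖A u‖ = ‖A c + A ((2 : ℝ) • u - c)‖ := by
            rw [← map_add, add_sub_cancel, map_smul, norm_smul]; simp
        _ ≤ ‖A c‖ + ‖A‖ * ‖(2 : ℝ) • u - c‖ :=
            (norm_add_le _ _).trans (by gcongr; exact A.le_opNorm _)
        _ ≤ M + ‖A‖ * 1 := by gcongr; exact hM c hc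
        _ = _ := by ring
    linarith
  linarith

lemma opNorm_le_of_net_inner {s : Finset H} (hs : ∀ v : H, ‖v‖ ≤ 2 → ∃ c ∈ s, ‖v - c‖ ≤ 1)
    (A : H →L[ℝ] H) {M : ℝ} (hM : ∀ c ∈ s, ∀ d ∈ s, |inner ℝ (A c) d| ≤ M) : ‖A‖ ≤ M := by
  refine opNorm_le_of_net hs A fun c hc => ?_
  rw [← innerSL_apply_norm (𝕜 := ℝ)]
  exact opNorm_le_of_net hs _ fun d hd => by simpa using hM c hc d hd

/-- A maximum is bounded by a sum, and both signs replace the absolute value. Only exponentials of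
forms linear in `A` remain, whose Gaussian means are explicit. -/
lemma exp_opNorm_le_sum_net {s : Finset H} (hs : ∀ v : H, ‖v‖ ≤ 2 → ∃ c ∈ s, ‖v - c‖ ≤ 1)
    (A : H →L[ℝ] H) {t : ℝ} (ht : 0 ≤ t) :
    Real.exp (t * ‖A‖) ≤ ∑ p ∈ s ×ˢ s,
      (Real.exp (t * inner ℝ (A p.1) p.2) + Real.exp (-t * inner ℝ (A p.1) p.2)) := by
  obtain ⟨c, hc, -⟩ := hs 0 (by simp)
  obtain ⟨p, hp, hmax⟩ := Finset.exists_max_image (s ×ˢ s) (fun p => |inner ℝ (A p.1) p.2|)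
    ⟨(c, c), by simp [hc]⟩
  have hA : ‖A‖ ≤ |inner ℝ (A p.1) p.2| := opNorm_le_of_net_inner hs A fun c hc d hd =>
    hmax (c, d) (by simp [hc, hd])
  refine le_trans ?_ (Finset.single_le_sum (fun q _ => by positivity) hp)
  rcases abs_cases (inner ℝ (A p.1) p.2) with ⟨h, -⟩ | ⟨h, -⟩ <;> rw [h] at hA
  · have := Real.exp_le_exp.2 (mul_le_mul_of_nonneg_left hA ht)
    linarith [Real.exp_pos (-t * inner ℝ (A p.1) p.2)]
  · have := Real.exp_le_exp.2 (mul_le_mul_of_nonneg_left hA ht)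
    rw [mul_neg, ← neg_mul] at this
    linarith [Real.exp_pos (t * inner ℝ (A p.1) p.2)]

end Net

section OpNorm

variable {E H : Type*} [NormedAddCommGroup E] [InnerProductSpace ℝ E] [FiniteDimensional ℝ E]
  [MeasurableSpace E] [BorelSpace E]
  [NormedAddCommGroup H] [InnerProductSpace ℝ H] [FiniteDimensional ℝ H]

lemma lintegral_exp_dual_stdGaussian (L : StrongDual ℝ E) (t : ℝ) :
    ∫⁻ x, ENNReal.ofReal (Real.exp (t * L x)) ∂(stdGaussian E) =
      ENNReal.ofReal (Real.exp (t ^ 2 * ‖L‖ ^ 2 / 2)) := by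
  have hmap := IsGaussian.map_eq_gaussianReal (μ := stdGaussian E) L
  have hexp : Integrable (fun x => Real.exp (t * L x)) (stdGaussian E) := by
    have := integrable_exp_mul_gaussianReal (μ := (stdGaussian E)[L])
      (v := Var[L; stdGaussian E].toNNReal) t
    rw [← hmap] at this
    exact this.comp_measurable (by fun_prop)
  rw [← ofReal_integral_eq_lintegral_ofReal hexp (ae_of_all _ fun _ => by positivity)]
  have h := mgf_gaussianReal hmap t
  rw [mgf] at h
  rw [h, integral_strongDual_stdGaussian, variance_dual_stdGaussian,
    Real.coe_toNNReal _ (by positivity)]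
  congr 2
  ring

/-- Union bound over at most `25 ^ dim` pairs of net points and two signs. Net points have norm at
most `2`, so each linear form has norm at most `4c`, whence the exponent `t²(4c)²/2`. -/
lemma lintegral_exp_opNorm_stdGaussian_le (S : E →L[ℝ] H →L[ℝ] H) {c t : ℝ}
    (hS : ‖S‖ ≤ c) (ht : 0 ≤ t) :
    ∫⁻ x, ENNReal.ofReal (Real.exp (t * ‖S x‖)) ∂(stdGaussian E) ≤
      ENNReal.ofReal (2 * 25 ^ Module.finrank ℝ H * Real.exp (8 * t ^ 2 * c ^ 2)) := by
  have hc0 : 0 ≤ c := S.opNorm_nonneg.trans hS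
  obtain ⟨s, hcard, hs2, hs⟩ := exists_finset_net H
  let L : H × H → StrongDual ℝ E := fun p => (innerSL ℝ p.2).comp (S.flip p.1)
  have hLapp : ∀ p x, L p x = inner ℝ (S x p.1) p.2 := fun p x => by
    simp [L, real_inner_comm]
  have hL : ∀ p ∈ s ×ˢ s, ‖L p‖ ≤ 4 * c := by
    intro p hp
    obtain ⟨h1, h2⟩ := Finset.mem_product.1 hp
    refine (L p).opNorm_le_bound (by positivity) fun x => ?_
    rw [hLapp]
    calc ‖inner ℝ (S x p.1) p.2‖ ≤ ‖S x p.1‖ * ‖p.2‖ := norm_inner_le_norm _ _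
      _ ≤ (‖S x‖ * ‖p.1‖) * ‖p.2‖ := by gcongr; exact (S x).le_opNorm _
      _ ≤ ((‖S‖ * ‖x‖) * ‖p.1‖) * ‖p.2‖ := by gcongr; exact S.le_opNorm _
      _ ≤ ((c * ‖x‖) * 2) * 2 := by
        have := hs2 _ h1
        have := hs2 _ h2
        gcongr
      _ = _ := by ring
  have hterm : ∀ p ∈ s ×ˢ s, ∫⁻ x, ENNReal.ofReal (Real.exp (t * L p x) + Real.exp (-t * L p x))
      ∂(stdGaussian E) ≤ ENNReal.ofReal (2 * Real.exp (8 * t ^ 2 * c ^ 2)) := by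
    intro p hp
    simp_rw [ENNReal.ofReal_add (Real.exp_pos _).le (Real.exp_pos _).le]
    rw [lintegral_add_left (by fun_prop), lintegral_exp_dual_stdGaussian,
      lintegral_exp_dual_stdGaussian, ← ENNReal.ofReal_add (by positivity) (by positivity)]
    apply ENNReal.ofReal_le_ofReal
    rw [neg_sq, ← two_mul]
    have h1 : t ^ 2 * ‖L p‖ ^ 2 / 2 ≤ 8 * t ^ 2 * c ^ 2 := by
      calc t ^ 2 * ‖L p‖ ^ 2 / 2 ≤ t ^ 2 * (4 * c) ^ 2 / 2 := by gcongr; exact hL p hp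
        _ = _ := by ring
    gcongr
  calc _ ≤ ∫⁻ x, ∑ p ∈ s ×ˢ s, ENNReal.ofReal (Real.exp (t * L p x) + Real.exp (-t * L p x))
        ∂(stdGaussian E) := by
        refine lintegral_mono fun x => ?_
        rw [← ENNReal.ofReal_sum_of_nonneg fun _ _ => by positivity]
        simp_rw [hLapp]
        exact ENNReal.ofReal_le_ofReal (exp_opNorm_le_sum_net hs (S x) ht)
    _ = ∑ p ∈ s ×ˢ s, ∫⁻ x, ENNReal.ofReal (Real.exp (t * L p x) + Real.exp (-t * L p x))
        ∂(stdGaussian E) := lintegral_finsetSum _ fun p _ => by fun_prop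
    _ ≤ ∑ p ∈ s ×ˢ s, ENNReal.ofReal (2 * Real.exp (8 * t ^ 2 * c ^ 2)) := Finset.sum_le_sum hterm
    _ = ENNReal.ofReal ((s.card * s.card : ℕ) * (2 * Real.exp (8 * t ^ 2 * c ^ 2))) := by
        rw [Finset.sum_const, Finset.card_product, nsmul_eq_mul,
          ← ENNReal.ofReal_natCast, ← ENNReal.ofReal_mul (by positivity)]
    _ ≤ _ := by
        apply ENNReal.ofReal_le_ofReal
        have h25 : ((s.card * s.card : ℕ) : ℝ) ≤ 25 ^ Module.finrank ℝ H := by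
          have : s.card * s.card ≤ 25 ^ Module.finrank ℝ H := by
            calc _ ≤ 5 ^ Module.finrank ℝ H * 5 ^ Module.finrank ℝ H := Nat.mul_le_mul hcard hcard
              _ = _ := by rw [← mul_pow]; norm_num
          exact_mod_cast this
        calc _ ≤ 25 ^ Module.finrank ℝ H * (2 * Real.exp (8 * t ^ 2 * c ^ 2)) := by gcongr
          _ = _ := by ring

/-- The moments of `‖S x‖ / √(dim H)` are bounded independently of the dimensions. -/
lemma lintegral_opNorm_div_sqrt_pow_le (S : E →L[ℝ] H →L[ℝ] H) {c : ℝ} (hS : ‖S‖ ≤ c)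
    (hH : 1 ≤ Module.finrank ℝ H) (q : ℕ) :
    ∫⁻ x, ENNReal.ofReal ((‖S x‖ / √(Module.finrank ℝ H)) ^ q) ∂(stdGaussian E) ≤
      ENNReal.ofReal (q.factorial * (2 * (50 * Real.exp (8 * c ^ 2)))) := by
  set n := Module.finrank ℝ H
  have hn : 0 < √(n : ℝ) := Real.sqrt_pos.2 (by exact_mod_cast hH)
  have hsq : √(n : ℝ) ^ 2 = n := Real.sq_sqrt (by positivity)
  -- Chosen so that the exponential moment at `t = √n`, namely `2 · 25^n · exp(8nc²)`, is at most
  -- `K^n`.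
  set K : ℝ := 50 * Real.exp (8 * c ^ 2) with hK
  have hK0 : 0 < K := by positivity
  have hpt : ∀ x, (‖S x‖ / √(n : ℝ)) ^ q ≤
      q.factorial * (K + K / K ^ n * Real.exp (√(n : ℝ) * ‖S x‖)) := by
    intro x
    set a := ‖S x‖ / √(n : ℝ) with ha
    have ha0 : 0 ≤ a := by positivity
    have h1 : a ^ q ≤ q.factorial * Real.exp a := by
      have := Real.pow_div_factorial_le_exp a ha0 q
      rwa [div_le_iff₀ (by positivity), mul_comm] at this
    have h2 : √(n : ℝ) * ‖S x‖ = n * a := by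
      rw [ha]
      field_simp
      rw [hsq, mul_comm]
    refine h1.trans ?_
    gcongr
    rw [h2, Real.exp_nat_mul]
    -- Above the threshold `K`, the ratio `exp a / K` is at most its `n`-th power, whose mean is at
    -- most `1`. This removes the dependence on `n`.
    rcases le_total (Real.exp a) K with h | h
    · have : 0 ≤ K / K ^ n * Real.exp a ^ n := by positivity
      linarith
    · have h3 : Real.exp a / K ≤ (Real.exp a / K) ^ n :=
        le_self_pow₀ ((one_le_div hK0).2 h) (by omega)
      calc Real.exp a = K * (Real.exp a / K) := by field_simp
        _ ≤ K * (Real.exp a / K) ^ n := by gcongr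
        _ = K / K ^ n * Real.exp a ^ n := by rw [div_pow]; ring
        _ ≤ _ := by linarith
  have hm : Measurable fun x => ENNReal.ofReal (Real.exp (√(n : ℝ) * ‖S x‖)) := by
    have : Continuous fun x => Real.exp (√(n : ℝ) * ‖S x‖) := by fun_prop
    exact ENNReal.measurable_ofReal.comp this.measurable
  have hexp : ∫⁻ x, ENNReal.ofReal (Real.exp (√(n : ℝ) * ‖S x‖)) ∂(stdGaussian E) ≤
      ENNReal.ofReal (K ^ n) := by
    refine (lintegral_exp_opNorm_stdGaussian_le S hS hn.le).trans (ENNReal.ofReal_le_ofReal ?_)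
    rw [hsq, hK, mul_pow, ← Real.exp_nat_mul]
    have h2 : (2 : ℝ) * 25 ^ n ≤ 50 ^ n := by
      calc (2 : ℝ) * 25 ^ n ≤ 2 ^ n * 25 ^ n := by
            gcongr
            exact le_self_pow₀ (by norm_num) (by omega)
        _ = 50 ^ n := by rw [← mul_pow]; norm_num
    have h3 : 8 * (n : ℝ) * c ^ 2 = n * (8 * c ^ 2) := by ring
    rw [h3]
    gcongr
  calc _ ≤ ∫⁻ x, ENNReal.ofReal (q.factorial * K) + ENNReal.ofReal (q.factorial * (K / K ^ n)) *
        ENNReal.ofReal (Real.exp (√(n : ℝ) * ‖S x‖)) ∂(stdGaussian E) := by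
        refine lintegral_mono fun x => ?_
        rw [← ENNReal.ofReal_mul (by positivity), ← ENNReal.ofReal_add (by positivity)
          (by positivity)]
        exact ENNReal.ofReal_le_ofReal ((hpt x).trans_eq (by ring))
    _ ≤ ENNReal.ofReal (q.factorial * K) + ENNReal.ofReal (q.factorial * (K / K ^ n)) *
        ENNReal.ofReal (K ^ n) := by
        rw [lintegral_add_left measurable_const, lintegral_const_mul _ hm]
        simp only [lintegral_const, measure_univ, mul_one]
        gcongr
    _ = _ := by
        rw [← ENNReal.ofReal_mul (by positivity), ← ENNReal.ofReal_add (by positivity)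
          (by positivity)]
        congr 1
        field_simp
        ring

end OpNorm

/-! ### Deterministic estimates on the AMP orbit -/

/-- The Euclidean norm of a vector of coordinates. -/
def l2Norm {n : ℕ} (v : Fin n → ℝ) : ℝ := ‖(WithLp.toLp 2 v : EuclideanSpace ℝ (Fin n))‖

/-- The `ℓ²` operator norm of a matrix. -/
def l2OpNorm {n : ℕ} (A : Matrix (Fin n) (Fin n) ℝ) : ℝ := ‖Matrix.toEuclideanCLM (𝕜 := ℝ) A‖

section Norms

variable {n : ℕ}

lemma l2Norm_nonneg (v : Fin n → ℝ) : 0 ≤ l2Norm v := norm_nonneg _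

lemma l2OpNorm_nonneg (A : Matrix (Fin n) (Fin n) ℝ) : 0 ≤ l2OpNorm A := norm_nonneg _

lemma l2Norm_eq_sqrt (v : Fin n → ℝ) : l2Norm v = √(∑ i, v i ^ 2) := by
  simp [l2Norm, EuclideanSpace.norm_eq]

lemma l2Norm_add_le (v w : Fin n → ℝ) : l2Norm (v + w) ≤ l2Norm v + l2Norm w := by
  simpa [l2Norm] using norm_add_le (WithLp.toLp 2 v : EuclideanSpace ℝ (Fin n)) (WithLp.toLp 2 w)

lemma l2Norm_smul (a : ℝ) (v : Fin n → ℝ) : l2Norm (a • v) = |a| * l2Norm v := by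
  simp [l2Norm, norm_smul]

lemma l2Norm_abs (v : Fin n → ℝ) : l2Norm (fun i => |v i|) = l2Norm v := by
  simp [l2Norm_eq_sqrt]

lemma l2Norm_const (a : ℝ) : l2Norm (fun _ : Fin n => a) = |a| * √n := by
  rw [l2Norm_eq_sqrt]
  simp [Real.sqrt_sq_eq_abs, mul_comm]

lemma l2Norm_mono {v w : Fin n → ℝ} (h : ∀ i, |v i| ≤ w i) : l2Norm v ≤ l2Norm w := by
  rw [l2Norm_eq_sqrt, l2Norm_eq_sqrt]
  refine Real.sqrt_le_sqrt (Finset.sum_le_sum fun i _ => ?_)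
  rw [← sq_abs (v i)]
  gcongr
  exact h i

lemma l2Norm_sum_le {ι : Type*} (s : Finset ι) (w : ι → Fin n → ℝ) :
    l2Norm (∑ j ∈ s, w j) ≤ ∑ j ∈ s, l2Norm (w j) := by
  simp only [l2Norm, WithLp.toLp_sum]
  exact norm_sum_le _ _

lemma l2Norm_mulVec_le (A : Matrix (Fin n) (Fin n) ℝ) (v : Fin n → ℝ) :
    l2Norm (A.mulVec v) ≤ l2OpNorm A * l2Norm v := by
  have h := (Matrix.toEuclideanCLM (𝕜 := ℝ) A).le_opNorm (WithLp.toLp 2 v)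
  rwa [Matrix.toEuclideanCLM_toLp] at h

lemma l2OpNorm_add_le (A B : Matrix (Fin n) (Fin n) ℝ) :
    l2OpNorm (A + B) ≤ l2OpNorm A + l2OpNorm B := by
  simp only [l2OpNorm, map_add]
  exact norm_add_le _ _

lemma l2OpNorm_smul (a : ℝ) (A : Matrix (Fin n) (Fin n) ℝ) :
    l2OpNorm (a • A) = |a| * l2OpNorm A := by
  simp [l2OpNorm, map_smul, norm_smul]

lemma l2OpNorm_le_frobenius (A : Matrix (Fin n) (Fin n) ℝ) :
    l2OpNorm A ≤ √(∑ i, ∑ j, A i j ^ 2) := by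
  refine ContinuousLinearMap.opNorm_le_bound _ (Real.sqrt_nonneg _) fun x => ?_
  rw [← WithLp.toLp_ofLp 2 x, Matrix.toEuclideanCLM_toLp]
  change l2Norm _ ≤ _ * l2Norm _
  rw [l2Norm_eq_sqrt, l2Norm_eq_sqrt, ← Real.sqrt_mul (by positivity), Finset.sum_mul]
  refine Real.sqrt_le_sqrt (Finset.sum_le_sum fun i _ => ?_)
  exact Finset.sum_mul_sq_le_sq_mul_sq Finset.univ (fun j => A i j) fun j => x j

lemma sum_abs_le_sqrt_mul_l2Norm (v : Fin n → ℝ) : ∑ i, |v i| ≤ √n * l2Norm v := by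
  rw [l2Norm_eq_sqrt, ← Real.sqrt_mul (by positivity)]
  refine Real.le_sqrt_of_sq_le ?_
  simpa using sq_sum_le_card_mul_sum_sq (s := Finset.univ) (f := fun i => |v i|)

/-- Serves for both growth (`a = |F k 0|`) and stability (`a = 0`) of one AMP step; `r` is the
memory. -/
lemma l2Norm_le_of_abs_le {k : ℕ} {a η : ℝ} (ha : 0 ≤ a) (hη : 0 ≤ η) {v w : Fin n → ℝ}
    {r : Fin k → Fin n → ℝ} (h : ∀ i, |v i| ≤ a + η * (|w i| + ∑ j, |r j i|)) :
    l2Norm v ≤ a * √n + η * (l2Norm w + ∑ j, l2Norm (r j)) := by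
  calc l2Norm v ≤ l2Norm ((fun _ => a) + η • ((fun i => |w i|) + ∑ j, fun i => |r j i|)) :=
        l2Norm_mono fun i => by simpa [mul_add] using h i
    _ ≤ l2Norm (fun _ : Fin n => a) + l2Norm (η • ((fun i => |w i|) + ∑ j, fun i => |r j i|)) :=
        l2Norm_add_le _ _
    _ ≤ a * √n + η * (l2Norm w + ∑ j, l2Norm (r j)) := by
        rw [l2Norm_const, l2Norm_smul, abs_of_nonneg ha, abs_of_nonneg hη]
        gcongr
        refine (l2Norm_add_le _ _).trans ?_
        rw [l2Norm_abs]
        gcongr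
        refine (l2Norm_sum_le _ _).trans_eq ?_
        simp_rw [l2Norm_abs]

end Norms

lemma pi_norm_le_sum_abs {ι : Type*} [Fintype ι] (v : ι → ℝ) : ‖v‖ ≤ ∑ i, |v i| :=
  (pi_norm_le_iff_of_nonneg (Finset.sum_nonneg fun _ _ => abs_nonneg _)).2 fun i =>
    Finset.single_le_sum (f := fun i => |v i|) (fun _ _ => abs_nonneg _) (Finset.mem_univ i)

lemma LipschitzWith.abs_sub_le_sum {ι : Type*} [Fintype ι] {f : (ι → ℝ) → ℝ} {η : NNReal}
    (hf : LipschitzWith η f) (v w : ι → ℝ) : |f v - f w| ≤ η * ∑ i, |v i - w i| := by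
  have h := hf.dist_le_mul v w
  rw [Real.dist_eq, dist_eq_norm] at h
  exact h.trans (by gcongr; exact pi_norm_le_sum_abs (v - w))

lemma LipschitzWith.abs_le_sum {ι : Type*} [Fintype ι] {f : (ι → ℝ) → ℝ} {η : NNReal}
    (hf : LipschitzWith η f) (v : ι → ℝ) : |f v| ≤ |f 0| + η * ∑ i, |v i| := by
  have h := hf.abs_sub_le_sum v 0
  simp only [Pi.zero_apply, sub_zero] at h
  have := abs_sub_abs_le_abs_sub (f v) (f 0)
  linarith

section Orbit

variable {n : ℕ} {F : (k : ℕ) → (Fin (k + 1) → ℝ) → ℝ}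

lemma ampOrbit_zero (Z X : Matrix (Fin n) (Fin n) ℝ)
    (init : Matrix (Fin n) (Fin n) ℝ → Fin n → ℝ) : ampOrbit F Z init 0 X = init X := by
  rw [ampOrbit]

lemma ampOrbit_succ (Z X : Matrix (Fin n) (Fin n) ℝ)
    (init : Matrix (Fin n) (Fin n) ℝ → Fin n → ℝ) (k : ℕ) (i : Fin n) :
    ampOrbit F Z init (k + 1) X i =
      F k (Fin.cons (Matrix.mulVec (hatMatrix X Z) (ampOrbit F Z init k X) i)
        (fun j : Fin k => ampOrbit F Z init (k - 1 - (j : ℕ)) X i)) := by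
  rw [ampOrbit]

lemma hatMatrix_sub (X Y Z : Matrix (Fin n) (Fin n) ℝ) :
    hatMatrix X Z - hatMatrix Y Z = (√(n : ℝ))⁻¹ • (X - Y) := by
  simp only [hatMatrix, smul_sub]
  abel

/-- Split as `(X̂ - Ŷ) v + Ŷ (v - w)`; the perturbation `Z` cancels in `X̂ - Ŷ`. -/
lemma l2Norm_hatMatrix_mulVec_sub_le (X Y Z : Matrix (Fin n) (Fin n) ℝ) (v w : Fin n → ℝ) :
    l2Norm ((hatMatrix X Z).mulVec v - (hatMatrix Y Z).mulVec w) ≤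
      (√(n : ℝ))⁻¹ * l2OpNorm (X - Y) * l2Norm v + l2OpNorm (hatMatrix Y Z) * l2Norm (v - w) := by
  have h : (hatMatrix X Z).mulVec v - (hatMatrix Y Z).mulVec w =
      (hatMatrix X Z - hatMatrix Y Z).mulVec v + (hatMatrix Y Z).mulVec (v - w) := by
    rw [Matrix.sub_mulVec, Matrix.mulVec_sub]
    abel
  rw [h, hatMatrix_sub]
  refine (l2Norm_add_le _ _).trans (add_le_add ((l2Norm_mulVec_le _ _).trans_eq ?_)
    (l2Norm_mulVec_le _ _))
  rw [l2OpNorm_smul, abs_of_nonneg (by positivity)]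

/-- Growth and stability of the AMP orbit, with constants that do not depend on the dimension. -/
lemma exists_ampOrbit_bound (hF : ∀ k, ∃ η, LipschitzWith η (F k)) (k : ℕ) :
    ∃ c : ℝ, 0 ≤ c ∧ ∀ (n : ℕ) (X Y Z : Matrix (Fin n) (Fin n) ℝ) (u : Fin n → ℝ) (S U : ℝ),
      1 ≤ n → 1 ≤ S → 1 ≤ U → l2OpNorm (hatMatrix X Z) ≤ S → l2OpNorm (hatMatrix Y Z) ≤ S →
      l2Norm u ≤ U * √n → ∀ j ≤ k,
      l2Norm (ampOrbit F Z (fun _ => u) j X) ≤ c * S ^ k * U * √n ∧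
      l2Norm (ampOrbit F Z (fun _ => u) j X - ampOrbit F Z (fun _ => u) j Y) ≤
        c * S ^ k * U * l2OpNorm (X - Y) := by
  induction k with
  | zero =>
    refine ⟨1, zero_le_one, fun n X Y Z u S U hn hS hU hX hY hu j hj => ?_⟩
    obtain rfl : j = 0 := by omega
    simp only [ampOrbit_zero, sub_self, pow_zero, one_mul]
    refine ⟨hu, ?_⟩
    have h0 : l2Norm (0 : Fin n → ℝ) = 0 := by simp [l2Norm]
    rw [h0]
    exact mul_nonneg (by linarith) (l2OpNorm_nonneg _)
  | succ k ih =>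
    obtain ⟨c, hc, ih⟩ := ih
    obtain ⟨η, hη⟩ := hF k
    -- The term `c` covers earlier iterates and `|F k 0|` the offset. Stability needs `2 + k`: two
    -- terms from the matrix product and `k` from the memory; growth needs only `1 + k`.
    refine ⟨c + |F k 0| + η * c * (2 + k), by positivity,
      fun n X Y Z u S U hn hS hU hX hY hu j hj => ?_⟩
    have hS0 : 0 ≤ S := by linarith
    have hU0 : 0 ≤ U := by linarith
    have hsn : 0 < √(n : ℝ) := Real.sqrt_pos.2 (by exact_mod_cast hn)
    set D := l2OpNorm (X - Y)
    have hD : 0 ≤ D := l2OpNorm_nonneg _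
    have ih' := ih n X Y Z u S U hn hS hU hX hY hu
    have hSk : S ^ k ≤ S ^ (k + 1) := pow_le_pow_right₀ hS (Nat.le_succ k)
    have hS1 : 1 ≤ S ^ (k + 1) := one_le_pow₀ hS
    rcases Nat.lt_or_ge j (k + 1) with hjk | hjk
    · obtain ⟨h1, h2⟩ := ih' j (by omega)
      have hcc : c ≤ c + |F k 0| + η * c * (2 + k) := by
        have : 0 ≤ |F k 0| + η * c * (2 + k) := by positivity
        linarith
      exact ⟨h1.trans (by gcongr), h2.trans (by gcongr)⟩
    · obtain rfl : j = k + 1 := by omega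
      obtain ⟨hk1, hk2⟩ := ih' k le_rfl
      set u' := fun j => ampOrbit F Z (fun _ => u) j X with hu'
      set v' := fun j => ampOrbit F Z (fun _ => u) j Y with hv'
      constructor
      · have h1 : l2Norm (u' (k + 1)) ≤ |F k 0| * √n + η * (l2Norm ((hatMatrix X Z).mulVec (u' k)) +
            ∑ j : Fin k, l2Norm (u' (k - 1 - j))) := by
          refine l2Norm_le_of_abs_le (abs_nonneg _) η.2 fun i => ?_
          simp only [hu', ampOrbit_succ]
          refine (hη.abs_le_sum _).trans_eq ?_
          simp [Fin.sum_univ_succ]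
        have h2 : l2Norm ((hatMatrix X Z).mulVec (u' k)) ≤ S * (c * S ^ k * U * √n) :=
          (l2Norm_mulVec_le _ _).trans (mul_le_mul hX hk1 (l2Norm_nonneg _) hS0)
        have h3 : ∑ j : Fin k, l2Norm (u' (k - 1 - j)) ≤ k * (c * S ^ (k + 1) * U * √n) := by
          have h : ∀ j : Fin k, _ ≤ c * S ^ (k + 1) * U * √n := fun j =>
            (ih' (k - 1 - j) (by omega)).1.trans (by gcongr)
          simpa using Finset.sum_le_sum fun j (_ : j ∈ Finset.univ) => h j
        calc l2Norm (u' (k + 1)) ≤ |F k 0| * √n + η * (S * (c * S ^ k * U * √n) +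
              k * (c * S ^ (k + 1) * U * √n)) := h1.trans (by gcongr)
          _ = |F k 0| * 1 * 1 * √n + η * c * (1 + k) * S ^ (k + 1) * U * √n := by ring
          _ ≤ |F k 0| * S ^ (k + 1) * U * √n + η * c * (2 + k) * S ^ (k + 1) * U * √n := by
              gcongr
              norm_num
          _ ≤ |F k 0| * S ^ (k + 1) * U * √n + η * c * (2 + k) * S ^ (k + 1) * U * √n +
              c * S ^ (k + 1) * U * √n := le_add_of_nonneg_right (by positivity)
          _ = _ := by ring
      · have h1 : l2Norm (u' (k + 1) - v' (k + 1)) ≤ 0 * √n +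
            η * (l2Norm ((hatMatrix X Z).mulVec (u' k) - (hatMatrix Y Z).mulVec (v' k)) +
            ∑ j : Fin k, l2Norm (u' (k - 1 - j) - v' (k - 1 - j))) := by
          refine l2Norm_le_of_abs_le le_rfl η.2 fun i => ?_
          simp only [hu', hv', Pi.sub_apply, ampOrbit_succ]
          refine (hη.abs_sub_le_sum _ _).trans_eq ?_
          simp [Fin.sum_univ_succ]
        have h2 : l2Norm ((hatMatrix X Z).mulVec (u' k) - (hatMatrix Y Z).mulVec (v' k)) ≤
            2 * (c * S ^ (k + 1) * U * D) := by
          calc _ ≤ (√(n : ℝ))⁻¹ * D * l2Norm (u' k) +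
                l2OpNorm (hatMatrix Y Z) * l2Norm (u' k - v' k) :=
                l2Norm_hatMatrix_mulVec_sub_le _ _ _ _ _
            _ ≤ (√(n : ℝ))⁻¹ * D * (c * S ^ k * U * √n) + S * (c * S ^ k * U * D) :=
                add_le_add (mul_le_mul_of_nonneg_left hk1 (by positivity))
                  (mul_le_mul hY hk2 (l2Norm_nonneg _) hS0)
            -- The `√n` in the growth of the orbit cancels the normalization `1/√n` of `X - Y`.
            _ = c * S ^ k * U * D + c * S ^ (k + 1) * U * D := by
                field_simp
                ring
            _ ≤ c * S ^ (k + 1) * U * D + c * S ^ (k + 1) * U * D := by gcongr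
            _ = _ := by ring
        have h3 : ∑ j : Fin k, l2Norm (u' (k - 1 - j) - v' (k - 1 - j)) ≤
            k * (c * S ^ (k + 1) * U * D) := by
          have h : ∀ j : Fin k, _ ≤ c * S ^ (k + 1) * U * D := fun j =>
            (ih' (k - 1 - j) (by omega)).2.trans (by gcongr)
          simpa using Finset.sum_le_sum fun j (_ : j ∈ Finset.univ) => h j
        calc l2Norm (u' (k + 1) - v' (k + 1)) ≤ 0 * √n + η * (2 * (c * S ^ (k + 1) * U * D) +
              k * (c * S ^ (k + 1) * U * D)) := h1.trans (by gcongr)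
          _ = η * c * (2 + k) * S ^ (k + 1) * U * D := by ring
          _ ≤ η * c * (2 + k) * S ^ (k + 1) * U * D + (c + |F k 0|) * S ^ (k + 1) * U * D :=
              le_add_of_nonneg_right (by positivity)
          _ = _ := by ring

/-- Growth and stability of the averages along the AMP orbit. -/
lemma exists_ampAverage_bound (hF : ∀ k, ∃ η, LipschitzWith η (F k)) (k : ℕ)
    {φ : (Fin (k + 1) → ℝ) → ℝ} (hφ : ∃ η, LipschitzWith η φ) :
    ∃ c : ℝ, 0 ≤ c ∧ ∀ (n : ℕ) (X Y Z : Matrix (Fin n) (Fin n) ℝ) (u : Fin n → ℝ) (S U : ℝ),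
      1 ≤ n → 1 ≤ S → 1 ≤ U → l2OpNorm (hatMatrix X Z) ≤ S → l2OpNorm (hatMatrix Y Z) ≤ S →
      l2Norm u ≤ U * √n →
      |ampAverage F Z (fun _ => u) k φ X| ≤ c * S ^ k * U ∧
      |ampAverage F Z (fun _ => u) k φ X - ampAverage F Z (fun _ => u) k φ Y| ≤
        c * S ^ k * U * (l2OpNorm (X - Y) / √n) := by
  obtain ⟨c, hc, hb⟩ := exists_ampOrbit_bound hF k
  obtain ⟨η, hη⟩ := hφ
  refine ⟨|φ 0| + η * (k + 1) * c, by positivity, fun n X Y Z u S U hn hS hU hX hY hu => ?_⟩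
  have hb' := hb n X Y Z u S U hn hS hU hX hY hu
  have hn0 : (0 : ℝ) < n := by exact_mod_cast hn
  have hsn : 0 < √(n : ℝ) := Real.sqrt_pos.2 hn0
  have hS0 : 0 ≤ S := by linarith
  have hU0 : 0 ≤ U := by linarith
  have hSk : 1 ≤ S ^ k := one_le_pow₀ hS
  have hD : 0 ≤ l2OpNorm (X - Y) := l2OpNorm_nonneg _
  -- Cauchy–Schwarz: a coordinate average is at most `1/√n` times the Euclidean norm.
  have hsum : ∀ (r : Fin (k + 1) → Fin n → ℝ) (B : ℝ), (∀ j, l2Norm (r j) ≤ B * √n) →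
      (n : ℝ)⁻¹ * ∑ i, ∑ j, |r j i| ≤ (k + 1) * B := by
    intro r B hr
    rw [Finset.sum_comm]
    calc (n : ℝ)⁻¹ * ∑ j, ∑ i, |r j i| ≤ (n : ℝ)⁻¹ * ∑ j : Fin (k + 1), √n * (B * √n) := by
          gcongr with j
          exact (sum_abs_le_sqrt_mul_l2Norm _).trans (by gcongr; exact hr j)
      _ = (√n * √n) / n * ((k + 1) * B) := by
          rw [Finset.sum_const, Finset.card_univ, Fintype.card_fin, nsmul_eq_mul]
          push_cast
          ring
      _ = _ := by rw [Real.mul_self_sqrt hn0.le, div_self hn0.ne', one_mul]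
  constructor
  · have h1 := hsum (fun j => ampOrbit F Z (fun _ => u) (k - j) X) (c * S ^ k * U)
      fun j => (hb' (k - j) (by omega)).1
    calc |ampAverage F Z (fun _ => u) k φ X|
        ≤ (n : ℝ)⁻¹ * ∑ i, (|φ 0| + η * ∑ j : Fin (k + 1), |ampOrbit F Z (fun _ => u) (k - j) X i|) := by
          rw [ampAverage, abs_mul, abs_of_nonneg (by positivity)]
          gcongr
          exact (Finset.abs_sum_le_sum_abs _ _).trans
            (Finset.sum_le_sum fun i _ => hη.abs_le_sum _)
      _ = |φ 0| + η * ((n : ℝ)⁻¹ * ∑ i, ∑ j : Fin (k + 1),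
            |ampOrbit F Z (fun _ => u) (k - j) X i|) := by
          rw [Finset.sum_add_distrib, ← Finset.mul_sum]
          simp
          field_simp
      _ ≤ |φ 0| * 1 * 1 + η * ((k + 1) * (c * S ^ k * U)) := by
          rw [mul_one, mul_one]
          gcongr
      _ ≤ |φ 0| * S ^ k * U + η * ((k + 1) * (c * S ^ k * U)) := by gcongr
      _ = _ := by ring
  · have h1 := hsum (fun j => ampOrbit F Z (fun _ => u) (k - j) X -
        ampOrbit F Z (fun _ => u) (k - j) Y) (c * S ^ k * U * (l2OpNorm (X - Y) / √n))
      fun j => (hb' (k - j) (by omega)).2.trans_eq (by field_simp)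
    calc |ampAverage F Z (fun _ => u) k φ X - ampAverage F Z (fun _ => u) k φ Y|
        ≤ (n : ℝ)⁻¹ * ∑ i, (η * ∑ j : Fin (k + 1), |ampOrbit F Z (fun _ => u) (k - j) X i -
            ampOrbit F Z (fun _ => u) (k - j) Y i|) := by
          rw [ampAverage, ampAverage, ← mul_sub, ← Finset.sum_sub_distrib, abs_mul,
            abs_of_nonneg (by positivity)]
          gcongr
          exact (Finset.abs_sum_le_sum_abs _ _).trans
            (Finset.sum_le_sum fun i _ => hη.abs_sub_le_sum _ _)
      _ = η * ((n : ℝ)⁻¹ * ∑ i, ∑ j : Fin (k + 1), |ampOrbit F Z (fun _ => u) (k - j) X i -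
            ampOrbit F Z (fun _ => u) (k - j) Y i|) := by
          rw [← Finset.mul_sum]; ring
      _ ≤ η * ((k + 1) * (c * S ^ k * U * (l2OpNorm (X - Y) / √n))) := by
          exact mul_le_mul_of_nonneg_left h1 η.2
      _ ≤ |φ 0| * S ^ k * U * (l2OpNorm (X - Y) / √n) +
            η * ((k + 1) * (c * S ^ k * U * (l2OpNorm (X - Y) / √n))) :=
          le_add_of_nonneg_left (by positivity)
      _ = _ := by ring

end Orbit

/-! ### Conditional variance of a function of independent variables -/

section CondVariance

/-- The conditional expectation is the best approximation in `L²`. -/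
lemma integral_sq_sub_condExp_le_of_memLp {Ω : Type*} {m m₀ : MeasurableSpace Ω} {P : Measure Ω}
    [IsProbabilityMeasure P] (hm : m ≤ m₀) {X h : Ω → ℝ} (hX : MemLp X 2 P)
    (hh : StronglyMeasurable[m] h) (hXh : MemLp (X - h) 2 P) :
    ∫ ω, |X ω - (P[X | m]) ω| ^ 2 ∂P ≤ ∫ ω, (X ω - h ω) ^ 2 ∂P := by
  have hhL : MemLp h 2 P := by simpa using hX.sub hXh
  have hhi : Integrable h P := hhL.integrable (by norm_num)
  have hXi : Integrable X P := hX.integrable (by norm_num)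
  have hce : P[X - h | m] =ᵐ[P] P[X | m] - h := by
    have := condExp_sub hXi hhi m
    rwa [condExp_of_stronglyMeasurable hm hh hhi] at this
  -- Subtracting an `m`-measurable `h` does not change the conditional variance, which is at most
  -- the conditional second moment.
  have hvar : ∫ ω, (X ω - (P[X | m]) ω) ^ 2 ∂P = ∫ ω, (Var[X - h; P | m]) ω ∂P := by
    rw [condVar, integral_condExp hm]
    refine integral_congr_ae ?_
    filter_upwards [hce] with ω hω
    simp only [Pi.pow_apply, Pi.sub_apply] at hω ⊢
    rw [hω]
    ring
  simp only [sq_abs]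
  rw [hvar]
  calc ∫ ω, (Var[X - h; P | m]) ω ∂P ≤ ∫ ω, (P[(X - h) ^ 2 | m]) ω ∂P :=
        integral_mono_ae integrable_condVar integrable_condExp (condVar_ae_le_condExp_sq hm hXh)
    _ = _ := by rw [integral_condExp hm]; rfl

/-- Jensen's inequality, obtained from the nonnegativity of the variance of `a - f`. -/
lemma ofReal_sq_sub_integral_le {A : Type*} [MeasurableSpace A] {γ : Measure A}
    [IsProbabilityMeasure γ] {f : A → ℝ} (hf : MemLp f 2 γ) (a : ℝ) :
    ENNReal.ofReal ((a - ∫ x, f x ∂γ) ^ 2) ≤ ∫⁻ x, ENNReal.ofReal ((a - f x) ^ 2) ∂γ := by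
  have hg : MemLp (fun x => a - f x) 2 γ := (memLp_const a).sub hf
  have h1 : a - ∫ x, f x ∂γ = ∫ x, (a - f x) ∂γ := by
    rw [integral_sub (integrable_const a) (hf.integrable (by norm_num))]
    simp
  rw [h1, ← ofReal_integral_eq_lintegral_ofReal hg.integrable_sq
    (ae_of_all _ fun _ => by positivity)]
  apply ENNReal.ofReal_le_ofReal
  have h2 := variance_nonneg (fun x => a - f x) γ
  rw [variance_eq_sub hg] at h2
  simpa using h2

lemma memLp_two_of_lintegral_sq_lt_top {Ω : Type*} [MeasurableSpace Ω] {P : Measure Ω}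
    {X : Ω → ℝ} (hX : AEStronglyMeasurable X P)
    (h : ∫⁻ ω, ENNReal.ofReal (X ω ^ 2) ∂P < ⊤) : MemLp X 2 P := by
  rw [memLp_two_iff_integrable_sq hX]
  exact (lintegral_ofReal_ne_top_iff_integrable (hX.pow 2) (ae_of_all _ fun _ => sq_nonneg _)).1
    h.ne

variable {Ω A B : Type*} [MeasurableSpace Ω] [MeasurableSpace A] [MeasurableSpace B]
  {P : Measure Ω} [IsProbabilityMeasure P] {γ : Measure A} [IsProbabilityMeasure γ]
  {ν : Measure B} [IsProbabilityMeasure ν] {g : Ω → A} {y : Ω → B} {f : A → B → ℝ}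

/-- The partial mean `h (y ω)`, with `h b = ∫ a, f a b ∂γ`, need not be identified with the
conditional expectation: as a competitor in the `L²` projection it already gives an upper bound.
Jensen then replaces `h` by an independent copy of `g`, the form in which the Poincaré inequality is
stated. -/
lemma integral_sq_sub_condExp_le_of_map_eq_prod (hg : Measurable g) (hy : Measurable y)
    (hlaw : P.map (fun ω => (g ω, y ω)) = γ.prod ν) (hf : Measurable (Function.uncurry f))
    (hf2 : MemLp (fun ω => f (g ω) (y ω)) 2 P) {K : ℝ} (hK : 0 ≤ K)
    (hbd : ∫⁻ b, ∫⁻ p, ENNReal.ofReal ((f p.1 b - f p.2 b) ^ 2) ∂(γ.prod γ) ∂ν ≤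
      ENNReal.ofReal K) :
    ∫ ω, |f (g ω) (y ω) - (P[fun ω => f (g ω) (y ω) | MeasurableSpace.comap y inferInstance]) ω| ^ 2
      ∂P ≤ K := by
  have hgy : Measurable fun ω => (g ω, y ω) := hg.prodMk hy
  have hf' : Measurable fun q : A × B => f q.1 q.2 := hf
  have hpush : ∀ F : A × B → ENNReal, Measurable F →
      ∫⁻ ω, F (g ω, y ω) ∂P = ∫⁻ b, ∫⁻ a, F (a, b) ∂γ ∂ν := by
    intro F hF
    rw [← lintegral_map hF hgy, hlaw, lintegral_prod_symm _ hF.aemeasurable]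
  set h : B → ℝ := fun b => ∫ a, f a b ∂γ with hh
  have hhm : StronglyMeasurable h := hf.stronglyMeasurable.integral_prod_left
  -- Makes `h b` a true mean for almost every `b`, not the default value of a divergent integral.
  have hsec : ∀ᵐ b ∂ν, MemLp (fun a => f a b) 2 γ := by
    have hfin : ∫⁻ b, ∫⁻ a, ENNReal.ofReal (f a b ^ 2) ∂γ ∂ν < ⊤ := by
      rw [← hpush (fun q => ENNReal.ofReal (f q.1 q.2 ^ 2)) (by fun_prop)]
      exact hf2.integrable_sq.lintegral_lt_top
    have hm : Measurable fun b => ∫⁻ a, ENNReal.ofReal (f a b ^ 2) ∂γ :=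
      Measurable.lintegral_prod_left' (f := fun q : A × B => ENNReal.ofReal (f q.1 q.2 ^ 2))
        (by fun_prop)
    filter_upwards [ae_lt_top hm hfin.ne] with b hb
    exact memLp_two_of_lintegral_sq_lt_top
      (hf'.comp (measurable_id.prodMk measurable_const)).aestronglyMeasurable hb
  have hXh : ∫⁻ ω, ENNReal.ofReal ((f (g ω) (y ω) - h (y ω)) ^ 2) ∂P ≤ ENNReal.ofReal K := by
    have hhm' := hhm.measurable
    rw [hpush (fun q => ENNReal.ofReal ((f q.1 q.2 - h q.2) ^ 2)) (by fun_prop)]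
    refine le_trans (lintegral_mono_ae ?_) hbd
    filter_upwards [hsec] with b hb
    have hfb : Measurable fun a => f a b := hf'.comp (measurable_id.prodMk measurable_const)
    rw [lintegral_prod _ (by fun_prop)]
    exact lintegral_mono fun a => ofReal_sq_sub_integral_le hb (f a b)
  have hmem : MemLp ((fun ω => f (g ω) (y ω)) - h ∘ y) 2 P :=
    memLp_two_of_lintegral_sq_lt_top
      (hf2.aestronglyMeasurable.sub (hhm.measurable.comp hy).aestronglyMeasurable)
      (hXh.trans_lt ENNReal.ofReal_lt_top)
  refine (integral_sq_sub_condExp_le_of_memLp hy.comap_le hf2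
    (hhm.comp_measurable (comap_measurable y)) hmem).trans ?_
  rw [← ENNReal.ofReal_le_ofReal_iff hK]
  exact (ofReal_integral_eq_lintegral_ofReal hmem.integrable_sq
    (ae_of_all _ fun _ => sq_nonneg _)).trans_le hXh

end CondVariance

/-! ### Symmetric matrices and their upper triangular entries -/

section Symm

/-- Positions on and above the diagonal. -/
abbrev UpperIndex (n : ℕ) : Type := {p : Fin n × Fin n // p.1 ≤ p.2}

variable {n : ℕ}

/-- The symmetric matrix with given entries on and above the diagonal. -/
def symmMatrix (x : EuclideanSpace ℝ (UpperIndex n)) : Matrix (Fin n) (Fin n) ℝ :=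
  fun i j => x ⟨(min i j, max i j), min_le_max⟩

/-- The entries of a matrix on and above the diagonal. -/
def upperEntries (A : Matrix (Fin n) (Fin n) ℝ) : EuclideanSpace ℝ (UpperIndex n) :=
  WithLp.toLp 2 fun p => A p.1.1 p.1.2

lemma symmMatrix_upperEntries {A : Matrix (Fin n) (Fin n) ℝ} (hA : A.IsSymm) :
    symmMatrix (upperEntries A) = A := by
  ext i j
  simp only [symmMatrix, upperEntries]
  rcases le_total i j with h | h
  · simp [h]
  · simpa [h] using hA.apply i j

/-- Each off-diagonal coordinate appears twice in the matrix, each diagonal one once. -/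
lemma sum_symmMatrix_sq_le (x : EuclideanSpace ℝ (UpperIndex n)) :
    ∑ i, ∑ j, symmMatrix x i j ^ 2 ≤ 2 * ‖x‖ ^ 2 := by
  set a : Fin n → Fin n → ℝ := fun i j => symmMatrix x i j ^ 2 with ha
  have hsymm : ∀ i j, a i j = a j i := fun i j => by
    simp only [ha, symmMatrix, min_comm i j, max_comm i j]
  have hhalf : ∑ i, ∑ j, (if i ≤ j then a i j else 0) = ‖x‖ ^ 2 := by
    rw [← Fintype.sum_prod_type' (fun i j => if i ≤ j then a i j else 0), ← Finset.sum_filter,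
      Finset.sum_subtype (p := fun p : Fin n × Fin n => p.1 ≤ p.2) _ (by simp),
      EuclideanSpace.real_norm_sq_eq]
    refine Finset.sum_congr rfl fun p _ => ?_
    simp only [ha, symmMatrix, min_eq_left p.2, max_eq_right p.2]
  have hpt : ∀ i j, a i j ≤ (if i ≤ j then a i j else 0) + if j ≤ i then a j i else 0 := by
    intro i j
    have h0 : 0 ≤ a i j := sq_nonneg _
    rw [hsymm j i]
    rcases le_total i j with h | h <;> simp only [h, if_true] <;> split_ifs <;> linarith
  calc ∑ i, ∑ j, a i j
      ≤ ∑ i, ∑ j, ((if i ≤ j then a i j else 0) + if j ≤ i then a j i else 0) := by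
        gcongr with i _ j _
        exact hpt i j
    _ = ∑ i, ∑ j, (if i ≤ j then a i j else 0) + ∑ i, ∑ j, (if j ≤ i then a j i else 0) := by
        simp_rw [Finset.sum_add_distrib]
    _ = 2 * ‖x‖ ^ 2 := by
        rw [Finset.sum_comm (f := fun i j => if j ≤ i then a j i else 0), hhalf]
        ring

lemma l2OpNorm_symmMatrix_le (x : EuclideanSpace ℝ (UpperIndex n)) :
    l2OpNorm (symmMatrix x) ≤ √2 * ‖x‖ := by
  refine (l2OpNorm_le_frobenius _).trans ?_
  rw [← Real.sqrt_sq (norm_nonneg x), ← Real.sqrt_mul (by norm_num)]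
  exact Real.sqrt_le_sqrt (sum_symmMatrix_sq_le x)

variable (n) in
/-- The symmetric matrix with given upper triangular entries, as an operator. -/
def symmCLM : EuclideanSpace ℝ (UpperIndex n) →L[ℝ]
    EuclideanSpace ℝ (Fin n) →L[ℝ] EuclideanSpace ℝ (Fin n) :=
  LinearMap.mkContinuous
    { toFun := fun x => Matrix.toEuclideanCLM (𝕜 := ℝ) (symmMatrix x)
      map_add' := fun x y => by rw [← map_add]; rfl
      map_smul' := fun c x => by rw [RingHom.id_apply, ← map_smul]; rfl }
    (√2) l2OpNorm_symmMatrix_le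

lemma norm_symmCLM_apply (x : EuclideanSpace ℝ (UpperIndex n)) :
    ‖symmCLM n x‖ = l2OpNorm (symmMatrix x) := rfl

variable (n) in
lemma norm_symmCLM_le : ‖symmCLM n‖ ≤ √2 := LinearMap.mkContinuous_norm_le _ (by positivity) _

lemma continuous_l2OpNorm_symmMatrix :
    Continuous fun x : EuclideanSpace ℝ (UpperIndex n) => l2OpNorm (symmMatrix x) :=
  (symmCLM n).continuous.norm

lemma measurable_symmMatrix : Measurable (symmMatrix (n := n)) := by
  refine measurable_pi_lambda _ fun i => measurable_pi_lambda _ fun j => ?_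
  simp only [symmMatrix]
  fun_prop

lemma measurable_upperEntries : Measurable (upperEntries (n := n)) := by
  have h : ∀ i j, Measurable fun A : Matrix (Fin n) (Fin n) ℝ => A i j := fun i j =>
    (measurable_pi_apply j).comp (measurable_pi_apply i)
  exact (WithLp.measurable_toLp 2 _).comp (measurable_pi_lambda _ fun p => h _ _)

lemma IsGaussianSymm.map_upperEntries {Ω : Type*} [MeasurableSpace Ω] {P : Measure Ω}
    [IsProbabilityMeasure P] {G : Ω → Matrix (Fin n) (Fin n) ℝ} (hG : IsGaussianSymm P G) :
    P.map (fun ω => upperEntries (G ω)) = stdGaussian (EuclideanSpace ℝ (UpperIndex n)) := by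
  have h : ∀ i j, Measurable fun A : Matrix (Fin n) (Fin n) ℝ => A i j := fun i j =>
    (measurable_pi_apply j).comp (measurable_pi_apply i)
  have hm : ∀ p : UpperIndex n, Measurable fun ω => G ω p.1.1 p.1.2 := fun p =>
    (h _ _).comp hG.measurable
  have h1 := (iIndepFun_iff_map_fun_eq_pi_map fun p => (hm p).aemeasurable).1 hG.indep
  rw [← map_pi_eq_stdGaussian]
  have h2 : (fun p : UpperIndex n => P.map fun ω => G ω p.1.1 p.1.2) =
      fun _ => gaussianReal 0 1 := funext fun p => hG.law _ _ p.2
  rw [h2] at h1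
  rw [← h1, Measure.map_map (WithLp.measurable_toLp 2 _) (measurable_pi_lambda _ hm)]
  rfl

lemma IsGaussianSymm.map_prod {Ω B : Type*} [MeasurableSpace Ω] [MeasurableSpace B]
    {P : Measure Ω} [IsProbabilityMeasure P] {G : Ω → Matrix (Fin n) (Fin n) ℝ}
    (hG : IsGaussianSymm P G) {y : Ω → B} (hy : Measurable y) (hind : IndepFun G y P) :
    P.map (fun ω => (upperEntries (G ω), y ω)) =
      (stdGaussian (EuclideanSpace ℝ (UpperIndex n))).prod (P.map y) := by
  rw [← hG.map_upperEntries]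
  exact (indepFun_iff_map_prod_eq_prod_map_map
    (measurable_upperEntries.comp hG.measurable).aemeasurable hy.aemeasurable).1
    (hind.comp measurable_upperEntries measurable_id)

end Symm

/-! ### Moment bounds -/

section Moments

/-- Normalized size of the initialization. -/
def initSize {n : ℕ} (u : Fin n → ℝ) : ℝ := 1 + l2Norm u / √n

/-- Normalized Frobenius size of the perturbation. -/
def perturbSize {n : ℕ} (Z : Matrix (Fin n) (Fin n) ℝ) : ℝ := 1 + √(∑ i, ∑ j, Z i j ^ 2) / n

/-- Normalized operator norm of the symmetric matrix with given upper triangular entries. -/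
def symmSize {n : ℕ} (x : EuclideanSpace ℝ (UpperIndex n)) : ℝ := 1 + l2OpNorm (symmMatrix x) / √n

variable {n : ℕ}

lemma one_le_initSize (u : Fin n → ℝ) : 1 ≤ initSize u :=
  le_add_of_nonneg_right (div_nonneg (l2Norm_nonneg _) (Real.sqrt_nonneg _))

lemma one_le_perturbSize (Z : Matrix (Fin n) (Fin n) ℝ) : 1 ≤ perturbSize Z :=
  le_add_of_nonneg_right (by positivity)

lemma one_le_symmSize (x : EuclideanSpace ℝ (UpperIndex n)) : 1 ≤ symmSize x :=
  le_add_of_nonneg_right (div_nonneg (l2OpNorm_nonneg _) (Real.sqrt_nonneg _))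

lemma continuous_symmSize : Continuous (symmSize (n := n)) := by
  have := continuous_l2OpNorm_symmMatrix (n := n)
  unfold symmSize
  fun_prop

/-- The bound `a + b ≤ (1 + a)(1 + b)` gives a product, so powers separate the Gaussian factor from
`Z`. The summands `1` also make both sizes at least `1`, as the orbit estimates require. -/
lemma l2OpNorm_hatMatrix_symmMatrix_le (x : EuclideanSpace ℝ (UpperIndex n))
    (Z : Matrix (Fin n) (Fin n) ℝ) :
    l2OpNorm (hatMatrix (symmMatrix x) Z) ≤ symmSize x * perturbSize Z := by
  have h1 : l2OpNorm (hatMatrix (symmMatrix x) Z) ≤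
      l2OpNorm (symmMatrix x) / √n + √(∑ i, ∑ j, Z i j ^ 2) / n := by
    rw [hatMatrix]
    refine (l2OpNorm_add_le _ _).trans ?_
    rw [l2OpNorm_smul, l2OpNorm_smul, abs_of_nonneg (by positivity), abs_of_nonneg (by positivity),
      ← div_eq_inv_mul, ← div_eq_inv_mul]
    gcongr
    exact l2OpNorm_le_frobenius Z
  refine h1.trans ?_
  have h2 : 0 ≤ l2OpNorm (symmMatrix x) / √n := div_nonneg (l2OpNorm_nonneg _) (Real.sqrt_nonneg _)
  have h3 : 0 ≤ √(∑ i, ∑ j, Z i j ^ 2) / n := by positivity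
  rw [symmSize, perturbSize]
  nlinarith [mul_nonneg h2 h3]

lemma one_add_pow_le {a : ℝ} (ha : 0 ≤ a) (q : ℕ) : (1 + a) ^ q ≤ 2 ^ q * (1 + a ^ q) := by
  calc (1 + a) ^ q ≤ (2 * max 1 a) ^ q := by
        gcongr
        linarith [le_max_left 1 a, le_max_right 1 a]
    _ = 2 ^ q * max 1 a ^ q := mul_pow _ _ _
    _ ≤ 2 ^ q * (1 + a ^ q) := by
        gcongr
        have : 0 ≤ a ^ q := by positivity
        rcases max_cases 1 a with ⟨h, -⟩ | ⟨h, -⟩ <;> rw [h]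
        · simpa using this
        · linarith

lemma exists_lintegral_symmSize_pow_le (q : ℕ) : ∃ K : ℝ, 0 ≤ K ∧ ∀ n : ℕ, 1 ≤ n →
    ∫⁻ x : EuclideanSpace ℝ (UpperIndex n), ENNReal.ofReal (symmSize x ^ q) ∂(stdGaussian _) ≤
      ENNReal.ofReal K := by
  refine ⟨2 ^ q + 2 ^ q * (q.factorial * (2 * (50 * Real.exp (8 * √2 ^ 2)))), by positivity,
    fun n hn => ?_⟩
  have h := lintegral_opNorm_div_sqrt_pow_le (symmCLM n) (norm_symmCLM_le n) (by simpa using hn) q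
  rw [finrank_euclideanSpace_fin] at h
  calc _ ≤ ∫⁻ x : EuclideanSpace ℝ (UpperIndex n), (ENNReal.ofReal (2 ^ q) +
        ENNReal.ofReal (2 ^ q) * ENNReal.ofReal ((‖symmCLM n x‖ / √n) ^ q)) ∂(stdGaussian _) := by
        refine lintegral_mono fun x => ?_
        rw [← ENNReal.ofReal_mul (by positivity), ← ENNReal.ofReal_add (by positivity)
          (by positivity)]
        refine ENNReal.ofReal_le_ofReal ((one_add_pow_le (by
          exact div_nonneg (l2OpNorm_nonneg _) (Real.sqrt_nonneg _)) q).trans_eq ?_)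
        rw [norm_symmCLM_apply]
        ring
    _ ≤ _ := by
        rw [lintegral_add_left measurable_const, lintegral_const_mul' _ _ ENNReal.ofReal_ne_top,
          ENNReal.ofReal_add (by positivity) (by positivity),
          ENNReal.ofReal_mul (p := 2 ^ q) (by positivity)]
        simp only [lintegral_const, measure_univ, mul_one]
        gcongr

lemma lintegral_pow_le_of_exp_moment {Ω : Type*} [MeasurableSpace Ω] {P : Measure Ω} {r : Ω → ℝ}
    {σ C : ℝ} (hσ : 0 < σ) (hr : ∀ ω, 0 ≤ r ω)
    (h : ∫⁻ ω, ENNReal.ofReal (Real.exp (r ω / σ)) ∂P ≤ ENNReal.ofReal C) (q : ℕ) :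
    ∫⁻ ω, ENNReal.ofReal (r ω ^ q) ∂P ≤ ENNReal.ofReal (σ ^ q * q.factorial * C) := by
  calc _ ≤ ∫⁻ ω, ENNReal.ofReal (σ ^ q * q.factorial) * ENNReal.ofReal (Real.exp (r ω / σ)) ∂P := by
        refine lintegral_mono fun ω => ?_
        rw [← ENNReal.ofReal_mul (by positivity)]
        apply ENNReal.ofReal_le_ofReal
        have h1 := Real.pow_div_factorial_le_exp (r ω / σ) (div_nonneg (hr ω) hσ.le) q
        rw [div_le_iff₀ (by positivity), div_pow, div_le_iff₀ (by positivity)] at h1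
        linarith
    _ ≤ _ := by
        rw [lintegral_const_mul' _ _ ENNReal.ofReal_ne_top, ENNReal.ofReal_mul (q := C) (by positivity)]
        gcongr

lemma initSize_pow_four_le (hn : 1 ≤ n) (u : Fin n → ℝ) :
    initSize u ^ 4 ≤ 16 + 16 * ((∑ i, u i ^ 2) / n) ^ 2 := by
  have h := one_add_pow_le (div_nonneg (l2Norm_nonneg u) (Real.sqrt_nonneg (n : ℝ))) 4
  have h2 : (l2Norm u / √n) ^ 2 = (∑ i, u i ^ 2) / n := by
    rw [div_pow, l2Norm_eq_sqrt, Real.sq_sqrt (by positivity), Real.sq_sqrt (by positivity)]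
  rw [← h2]
  refine h.trans_eq ?_
  ring

/-- The squared Frobenius norm over `n²` is the mean of the squared entries, so by Jensen its powers
reduce to moments of single entries; no independence within `Z` is needed. -/
lemma perturbSize_pow_le (hn : 1 ≤ n) (Z : Matrix (Fin n) (Fin n) ℝ) (k : ℕ) :
    perturbSize Z ^ (4 * k) ≤ 2 ^ (4 * k) +
      ∑ p : Fin n × Fin n, 2 ^ (4 * k) / (n : ℝ) ^ 2 * |Z p.1 p.2| ^ (4 * k) := by
  have hn0 : (n : ℝ) ≠ 0 := by positivity
  set s := √(∑ i, ∑ j, Z i j ^ 2) / n with hs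
  have h := one_add_pow_le (a := s) (by positivity) (4 * k)
  have hsq : s ^ 2 = ∑ p : Fin n × Fin n, ((n : ℝ) ^ 2)⁻¹ * |Z p.1 p.2| ^ 2 := by
    rw [hs, div_pow, Real.sq_sqrt (by positivity), ← Fintype.sum_prod_type', ← Finset.mul_sum,
      div_eq_inv_mul]
    simp only [sq_abs]
  have hpow : s ^ (4 * k) ≤ ∑ p : Fin n × Fin n, ((n : ℝ) ^ 2)⁻¹ * |Z p.1 p.2| ^ (4 * k) := by
    have h1 := Real.pow_arith_mean_le_arith_mean_pow Finset.univ
      (fun _ : Fin n × Fin n => ((n : ℝ) ^ 2)⁻¹) (fun p => |Z p.1 p.2| ^ 2)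
      (fun _ _ => by positivity) (by simp; field_simp) (fun _ _ => by positivity) (2 * k)
    rw [← hsq, ← pow_mul] at h1
    simp_rw [← pow_mul] at h1
    convert! h1 using 2 <;> ring_nf
  calc perturbSize Z ^ (4 * k) ≤ 2 ^ (4 * k) * (1 + s ^ (4 * k)) := h
    _ ≤ 2 ^ (4 * k) * (1 + ∑ p : Fin n × Fin n, ((n : ℝ) ^ 2)⁻¹ * |Z p.1 p.2| ^ (4 * k)) := by
        gcongr
    _ = _ := by
        rw [mul_add, mul_one, Finset.mul_sum]
        congr 1
        refine Finset.sum_congr rfl fun p _ => ?_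
        ring

lemma lintegral_size_le {Ω : Type*} [MeasurableSpace Ω] {P : Measure Ω} [IsProbabilityMeasure P]
    (hn : 1 ≤ n) {u : Ω → Fin n → ℝ} {Z : Ω → Matrix (Fin n) (Fin n) ℝ} (hu : Measurable u)
    (hZ : Measurable Z) {σ C : ℝ} (hσ : 0 < σ) (hC : 0 ≤ C)
    (hu_exp : ∫⁻ ω, ENNReal.ofReal (Real.exp ((∑ i, (u ω i) ^ 2) / (σ * n))) ∂P ≤
      ENNReal.ofReal C)
    (hZ_exp : ∀ i j, ∫⁻ ω, ENNReal.ofReal (Real.exp (|Z ω i j| / σ)) ∂P ≤ ENNReal.ofReal C)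
    (k : ℕ) :
    ∫⁻ ω, ENNReal.ofReal (initSize (u ω) ^ 2 * perturbSize (Z ω) ^ (2 * k)) ∂P ≤
      ENNReal.ofReal ((16 + 2 ^ (4 * k)) + (16 * (σ ^ 2 * Nat.factorial 2 * C) +
        2 ^ (4 * k) * (σ ^ (4 * k) * (4 * k).factorial * C))) := by
  have hn0 : (n : ℝ) ≠ 0 := by positivity
  have hu_mom : ∫⁻ ω, ENNReal.ofReal (((∑ i, u ω i ^ 2) / n) ^ 2) ∂P ≤
      ENNReal.ofReal (σ ^ 2 * Nat.factorial 2 * C) :=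
    lintegral_pow_le_of_exp_moment hσ (fun ω => by positivity)
      (by simpa only [div_div, mul_comm σ] using hu_exp) 2
  have hZ_mom : ∀ p : Fin n × Fin n, ∫⁻ ω, ENNReal.ofReal (|Z ω p.1 p.2| ^ (4 * k)) ∂P ≤
      ENNReal.ofReal (σ ^ (4 * k) * (4 * k).factorial * C) := fun p =>
    lintegral_pow_le_of_exp_moment hσ (fun ω => abs_nonneg _) (hZ_exp p.1 p.2) (4 * k)
  have hui : ∀ i, Measurable fun ω => u ω i := fun i => (measurable_pi_apply i).comp hu
  have hZi : ∀ i j, Measurable fun ω => Z ω i j := fun i j =>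
    (measurable_pi_apply j).comp ((measurable_pi_apply i).comp hZ)
  have hpt : ∀ ω, initSize (u ω) ^ 2 * perturbSize (Z ω) ^ (2 * k) ≤ (16 + 2 ^ (4 * k)) +
      (16 * ((∑ i, u ω i ^ 2) / n) ^ 2 +
        ∑ p : Fin n × Fin n, 2 ^ (4 * k) / (n : ℝ) ^ 2 * |Z ω p.1 p.2| ^ (4 * k)) := by
    intro ω
    have h1 := initSize_pow_four_le hn (u ω)
    have h2 := perturbSize_pow_le hn (Z ω) k
    have h3 : (perturbSize (Z ω) ^ (2 * k)) ^ 2 = perturbSize (Z ω) ^ (4 * k) := by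
      rw [← pow_mul]; congr 1; ring
    -- Since `u^0` and `Z` may be dependent, the product is split by `2ab ≤ a² + b²`; hence the
    -- powers `4` and `4k`.
    nlinarith [sq_nonneg (initSize (u ω) ^ 2 - perturbSize (Z ω) ^ (2 * k)),
      sq_nonneg (initSize (u ω) ^ 2), sq_nonneg (perturbSize (Z ω) ^ (2 * k))]
  obtain ⟨c₀, hc₀, hc₀0⟩ : ∃ c₀ : ℝ, 16 + 2 ^ (4 * k) = c₀ ∧ 0 ≤ c₀ := ⟨_, rfl, by positivity⟩
  rw [hc₀]
  simp only [hc₀] at hpt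
  calc _ ≤ ∫⁻ ω, (ENNReal.ofReal c₀ +
        (ENNReal.ofReal 16 * ENNReal.ofReal (((∑ i, u ω i ^ 2) / n) ^ 2) +
        ∑ p : Fin n × Fin n, ENNReal.ofReal (2 ^ (4 * k) / (n : ℝ) ^ 2) *
          ENNReal.ofReal (|Z ω p.1 p.2| ^ (4 * k)))) ∂P := by
        refine lintegral_mono fun ω => (ENNReal.ofReal_le_ofReal (hpt ω)).trans_eq ?_
        rw [ENNReal.ofReal_add (by positivity) (by positivity),
          ENNReal.ofReal_add (by positivity) (by positivity),
          ENNReal.ofReal_mul (p := 16) (by positivity),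
          ENNReal.ofReal_sum_of_nonneg fun _ _ => by positivity]
        congr 2
        exact Finset.sum_congr rfl fun p _ => ENNReal.ofReal_mul (by positivity)
    _ = ENNReal.ofReal c₀ +
        (ENNReal.ofReal 16 * ∫⁻ ω, ENNReal.ofReal (((∑ i, u ω i ^ 2) / n) ^ 2) ∂P +
        ∑ p : Fin n × Fin n, ENNReal.ofReal (2 ^ (4 * k) / (n : ℝ) ^ 2) *
          ∫⁻ ω, ENNReal.ofReal (|Z ω p.1 p.2| ^ (4 * k)) ∂P) := by
        rw [lintegral_add_left measurable_const, lintegral_add_left (by fun_prop),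
          lintegral_const_mul _ (by fun_prop), lintegral_finsetSum _ fun p _ => by fun_prop]
        simp only [lintegral_const, measure_univ, mul_one]
        congr 2
        exact Finset.sum_congr rfl fun p _ => lintegral_const_mul _ (by fun_prop)
    _ ≤ ENNReal.ofReal c₀ +
        (ENNReal.ofReal 16 * ENNReal.ofReal (σ ^ 2 * Nat.factorial 2 * C) +
        ∑ _p : Fin n × Fin n, ENNReal.ofReal (2 ^ (4 * k) / (n : ℝ) ^ 2) *
          ENNReal.ofReal (σ ^ (4 * k) * (4 * k).factorial * C)) := by
        gcongr with p
        exact hZ_mom p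
    _ = _ := by
        rw [ENNReal.ofReal_add (by positivity) (by positivity),
          ENNReal.ofReal_add (by positivity) (by positivity),
          ENNReal.ofReal_mul (p := 16) (by norm_num)]
        congr 2
        rw [Finset.sum_const, nsmul_eq_mul, ← ENNReal.ofReal_mul (by positivity),
          ← ENNReal.ofReal_natCast, ← ENNReal.ofReal_mul (by positivity)]
        congr 1
        simp only [Finset.card_univ, Fintype.card_prod, Fintype.card_fin]
        push_cast
        field_simp

end Moments

/-! ### Averages along the AMP orbit of a Gaussian matrix -/

section Average

variable {F : (k : ℕ) → (Fin (k + 1) → ℝ) → ℝ} {k : ℕ} {φ : (Fin (k + 1) → ℝ) → ℝ}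

lemma measurable_ampOrbit {A : Type*} [MeasurableSpace A] {n : ℕ}
    (hF : ∀ k, ∃ η, LipschitzWith η (F k)) {X Z : A → Matrix (Fin n) (Fin n) ℝ}
    {u : A → Fin n → ℝ} (hX : Measurable X) (hZ : Measurable Z) (hu : Measurable u) (k : ℕ) :
    ∀ i, Measurable fun a => ampOrbit F (Z a) (fun _ => u a) k (X a) i := by
  have hentry : ∀ {Y : A → Matrix (Fin n) (Fin n) ℝ}, Measurable Y →
      ∀ i j, Measurable fun a => Y a i j := fun hY i j =>
    (measurable_pi_apply j).comp ((measurable_pi_apply i).comp hY)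
  have hXe := hentry hX
  have hZe := hentry hZ
  induction k using Nat.strong_induction_on with
  | _ k ih =>
    intro i
    rcases k with _ | k
    · simp only [ampOrbit_zero]
      exact (measurable_pi_apply i).comp hu
    · simp only [ampOrbit_succ]
      obtain ⟨η, hη⟩ := hF k
      refine hη.continuous.measurable.comp (measurable_pi_lambda _ fun j => ?_)
      refine Fin.cases ?_ (fun j => ?_) j
      · simp only [Fin.cons_zero, Matrix.mulVec, dotProduct, hatMatrix, Matrix.add_apply,
          Matrix.smul_apply, smul_eq_mul]
        exact Finset.measurable_sum _ fun j _ => (((hXe i j).const_mul _).add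
          ((hZe i j).const_mul _)).mul (ih k (Nat.lt_succ_self k) j)
      · simp only [Fin.cons_succ]
        exact ih _ (by omega) i

lemma measurable_ampAverage {A : Type*} [MeasurableSpace A] {n : ℕ}
    (hF : ∀ k, ∃ η, LipschitzWith η (F k)) (hφ : ∃ η, LipschitzWith η φ)
    {X Z : A → Matrix (Fin n) (Fin n) ℝ}
    {u : A → Fin n → ℝ} (hX : Measurable X) (hZ : Measurable Z) (hu : Measurable u) :
    Measurable fun a => ampAverage F (Z a) (fun _ => u a) k φ (X a) := by
  obtain ⟨η, hη⟩ := hφ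
  unfold ampAverage
  refine measurable_const.mul (Finset.measurable_sum _ fun i _ => ?_)
  exact hη.continuous.measurable.comp
    (measurable_pi_lambda _ fun j => measurable_ampOrbit hF hX hZ hu _ i)

/-- Second moment and variance of the averages, for a fixed initialization and perturbation. -/
lemma exists_ampAverage_moment_bound (hF : ∀ k, ∃ η, LipschitzWith η (F k)) (k : ℕ)
    {φ : (Fin (k + 1) → ℝ) → ℝ} (hφ : ∃ η, LipschitzWith η φ) :
    ∃ K : ℝ, 0 ≤ K ∧ ∀ n : ℕ, 1 ≤ n → ∀ (u : Fin n → ℝ) (Z : Matrix (Fin n) (Fin n) ℝ),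
      ∫⁻ x, ENNReal.ofReal (ampAverage F Z (fun _ => u) k φ (symmMatrix x) ^ 2) ∂(stdGaussian _) ≤
        ENNReal.ofReal K * ENNReal.ofReal (initSize u ^ 2 * perturbSize Z ^ (2 * k)) ∧
      ∫⁻ p, ENNReal.ofReal ((ampAverage F Z (fun _ => u) k φ (symmMatrix p.1) -
          ampAverage F Z (fun _ => u) k φ (symmMatrix p.2)) ^ 2)
          ∂((stdGaussian _).prod (stdGaussian _)) ≤
        ENNReal.ofReal (K / n) * ENNReal.ofReal (initSize u ^ 2 * perturbSize Z ^ (2 * k)) := by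
  obtain ⟨c, hc, hb⟩ := exists_ampAverage_bound hF k hφ
  obtain ⟨K, hK, hmom⟩ := exists_lintegral_symmSize_pow_le (2 * k)
  -- The factor `π²` is the Poincaré constant and `2` is the square of the norm bound `√2` for
  -- `symmMatrix`.
  refine ⟨Real.pi ^ 2 * 2 * c ^ 2 * K, by positivity, fun n hn u Z => ?_⟩
  have hn0 : (0 : ℝ) < n := by exact_mod_cast hn
  have hsn : 0 < √(n : ℝ) := Real.sqrt_pos.2 hn0
  set U := initSize u with hU
  set W := perturbSize Z with hW
  have hU1 : 1 ≤ U := one_le_initSize u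
  have hW1 : 1 ≤ W := one_le_perturbSize Z
  have hu : l2Norm u ≤ U * √n := by
    rw [hU, initSize, add_mul, div_mul_cancel₀ _ hsn.ne']
    linarith
  have hmomW : ∀ a : ℝ, 0 ≤ a →
      ∫⁻ x : EuclideanSpace ℝ (UpperIndex n), ENNReal.ofReal (a * symmSize x ^ (2 * k))
        ∂(stdGaussian _) ≤ ENNReal.ofReal (a * K) := by
    intro a ha
    simp_rw [ENNReal.ofReal_mul ha]
    rw [lintegral_const_mul' _ _ ENNReal.ofReal_ne_top]
    gcongr
    exact hmom n hn
  constructor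
  · calc _ ≤ ∫⁻ x : EuclideanSpace ℝ (UpperIndex n),
          ENNReal.ofReal (c ^ 2 * W ^ (2 * k) * U ^ 2 * symmSize x ^ (2 * k)) ∂(stdGaussian _) := by
          refine lintegral_mono fun x => ENNReal.ofReal_le_ofReal ?_
          have hx := one_le_symmSize x
          have h := (hb n (symmMatrix x) (symmMatrix x) Z u (symmSize x * W) U hn
            (one_le_mul_of_one_le_of_one_le hx hW1) hU1 (l2OpNorm_hatMatrix_symmMatrix_le x Z)
            (l2OpNorm_hatMatrix_symmMatrix_le x Z) hu).1
          rw [← sq_abs]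
          calc _ ≤ (c * (symmSize x * W) ^ k * U) ^ 2 := by gcongr
            _ = _ := by ring
      _ ≤ ENNReal.ofReal (c ^ 2 * W ^ (2 * k) * U ^ 2 * K) := hmomW _ (by positivity)
      _ ≤ _ := by
          rw [← ENNReal.ofReal_mul (by positivity)]
          apply ENNReal.ofReal_le_ofReal
          have hpi : 1 ≤ Real.pi ^ 2 * 2 := by nlinarith [Real.pi_gt_three]
          calc _ = 1 * (c ^ 2 * W ^ (2 * k) * U ^ 2 * K) := by ring
            _ ≤ Real.pi ^ 2 * 2 * (c ^ 2 * W ^ (2 * k) * U ^ 2 * K) := by gcongr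
            _ = _ := by ring
  · set b : EuclideanSpace ℝ (UpperIndex n) → ℝ :=
      fun x => c * W ^ k * U * √2 / √n * symmSize x ^ k with hbdef
    have hbc : Continuous b := by
      have := continuous_symmSize (n := n)
      fun_prop
    have hb0 : ∀ x, 0 ≤ b x := fun x => by
      have := one_le_symmSize x
      positivity
    -- A crude bound, used only to justify the Poincaré inequality; its constant does not enter the
    -- variance estimate.
    have hgrow : ∀ x, b x ≤ c * W ^ k * U * √2 / √n * 2 ^ k * (1 + ‖x‖) ^ k := by
      intro x
      have hx := one_le_symmSize x
      have h1 : symmSize x ≤ 2 * (1 + ‖x‖) := by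
        have h2 : l2OpNorm (symmMatrix x) / √n ≤ √2 * ‖x‖ / 1 := by
          gcongr
          · exact l2OpNorm_symmMatrix_le x
          · exact Real.one_le_sqrt.2 (by exact_mod_cast hn)
        have h3 : √2 ≤ 2 := Real.sqrt_le_iff.2 ⟨by norm_num, by norm_num⟩
        rw [symmSize]
        nlinarith [norm_nonneg x]
      calc b x ≤ c * W ^ k * U * √2 / √n * (2 * (1 + ‖x‖)) ^ k := by
            simp only [hbdef]
            gcongr
        _ = _ := by rw [mul_pow]; ring
    have hlip : ∀ x y, |ampAverage F Z (fun _ => u) k φ (symmMatrix x) -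
        ampAverage F Z (fun _ => u) k φ (symmMatrix y)| ≤ (b x + b y) * ‖x - y‖ := by
      intro x y
      have hx := one_le_symmSize x
      have hy := one_le_symmSize y
      set S := max (symmSize x) (symmSize y) with hS
      have hS1 : 1 ≤ S := hx.trans (le_max_left _ _)
      have h := (hb n (symmMatrix x) (symmMatrix y) Z u (S * W) U hn
        (one_le_mul_of_one_le_of_one_le hS1 hW1) hU1
        ((l2OpNorm_hatMatrix_symmMatrix_le x Z).trans (by gcongr; exact le_max_left _ _))
        ((l2OpNorm_hatMatrix_symmMatrix_le y Z).trans (by gcongr; exact le_max_right _ _)) hu).2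
      -- Turns the maximum of the two sizes into the form `b x + b y`.
      have hSk : S ^ k ≤ symmSize x ^ k + symmSize y ^ k := by
        have h1 : 0 ≤ symmSize x ^ k := by positivity
        have h2 : 0 ≤ symmSize y ^ k := by positivity
        rcases max_cases (symmSize x) (symmSize y) with ⟨h, -⟩ | ⟨h, -⟩ <;> rw [hS, h] <;> linarith
      have hD : l2OpNorm (symmMatrix x - symmMatrix y) ≤ √2 * ‖x - y‖ :=
        l2OpNorm_symmMatrix_le (x - y)
      calc _ ≤ c * (S * W) ^ k * U * (l2OpNorm (symmMatrix x - symmMatrix y) / √n) := h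
        _ ≤ c * (S * W) ^ k * U * (√2 * ‖x - y‖ / √n) := by gcongr
        _ = c * W ^ k * U * √2 / √n * ‖x - y‖ * S ^ k := by rw [mul_pow]; ring
        _ ≤ c * W ^ k * U * √2 / √n * ‖x - y‖ * (symmSize x ^ k + symmSize y ^ k) := by gcongr
        _ = _ := by simp only [hbdef]; ring
    refine (gaussian_poincare hbc hb0 hgrow hlip).trans ?_
    have hbsq : ∀ x, b x ^ 2 = c ^ 2 * W ^ (2 * k) * U ^ 2 * 2 / n * symmSize x ^ (2 * k) := by
      intro x
      simp only [hbdef]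
      rw [mul_pow, div_pow, mul_pow _ (√2), Real.sq_sqrt (by norm_num), Real.sq_sqrt hn0.le]
      ring
    simp_rw [hbsq]
    calc _ ≤ ENNReal.ofReal (Real.pi ^ 2) *
          ENNReal.ofReal (c ^ 2 * W ^ (2 * k) * U ^ 2 * 2 / n * K) := by
          gcongr
          exact hmomW _ (by positivity)
      _ = _ := by
          rw [← ENNReal.ofReal_mul (by positivity), ← ENNReal.ofReal_mul (by positivity)]
          congr 1
          ring

end Average

end

/-! ### The concentration theorem -/

theorem theorem4
    {Ω : ℕ → Type*} [∀ n, MeasurableSpace (Ω n)]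
    (P : (n : ℕ) → Measure (Ω n)) [∀ n, IsProbabilityMeasure (P n)]
    (u0 : (n : ℕ) → Ω n → Fin n → ℝ)
    (Z G : (n : ℕ) → Ω n → Matrix (Fin n) (Fin n) ℝ)
    (hu0 : ∀ n, Measurable (u0 n))
    (hZ : ∀ n, Measurable (Z n))
    (hZsymm : ∀ n ω, (Z n ω).IsSymm)
    (σ C : ℝ) (hσ : 0 < σ)
    -- uniform exponential moment bounds, with expectations taken in `[0, ∞]`
    (hu0_norm : ∀ n, 1 ≤ n →
      ∫⁻ ω, ENNReal.ofReal (Real.exp ((∑ i, (u0 n ω i) ^ 2) / (σ * n))) ∂(P n) ≤ ENNReal.ofReal C)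
    (hu0_coord : ∀ n, 1 ≤ n → ∀ i,
      ∫⁻ ω, ENNReal.ofReal (Real.exp (|u0 n ω i| / σ)) ∂(P n) ≤ ENNReal.ofReal C)
    (hZ_entry : ∀ n, 1 ≤ n → ∀ i i',
      ∫⁻ ω, ENNReal.ofReal (Real.exp (|Z n ω i i'| / σ)) ∂(P n) ≤ ENNReal.ofReal C)
    (hG : ∀ n, IsGaussianSymm (P n) (G n))
    (hindep : ∀ n, IndepFun (G n) (fun ω => (u0 n ω, Z n ω)) (P n))
    (F : (k : ℕ) → (Fin (k + 1) → ℝ) → ℝ)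
    (hF : ∀ k, ∃ η, LipschitzWith η (F k))
    (k : ℕ) (φ : (Fin (k + 1) → ℝ) → ℝ) (hφ : ∃ η, LipschitzWith η φ) :
    (∀ n, 1 ≤ n → MemLp (randomAverage F k φ (u0 n) (Z n) (G n)) 2 (P n)) ∧
    Tendsto
      (fun n => ∫ ω, |randomAverage F k φ (u0 n) (Z n) (G n) ω -
        ((P n)[randomAverage F k φ (u0 n) (Z n) (G n) |
          MeasurableSpace.comap (fun ω => (u0 n ω, Z n ω)) inferInstance]) ω| ^ 2 ∂(P n))
      atTop (𝓝 0) := by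

  obtain ⟨K, hK, hmom⟩ := exists_ampAverage_moment_bound hF k hφ
  -- The uniform moment bound of `lintegral_size_le`, with `|C|` because `C` has no assumed sign.
  set M : ℝ := (16 + 2 ^ (4 * k)) + (16 * (σ ^ 2 * Nat.factorial 2 * |C|) +
    2 ^ (4 * k) * (σ ^ (4 * k) * (4 * k).factorial * |C|)) with hM
  have hM0 : 0 ≤ M := by positivity
  have hC : ENNReal.ofReal C ≤ ENNReal.ofReal |C| := ENNReal.ofReal_le_ofReal (le_abs_self C)
  let y : (n : ℕ) → Ω n → (Fin n → ℝ) × Matrix (Fin n) (Fin n) ℝ := fun n ω => (u0 n ω, Z n ω)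
  let f : (n : ℕ) → EuclideanSpace ℝ (UpperIndex n) → (Fin n → ℝ) × Matrix (Fin n) (Fin n) ℝ → ℝ :=
    fun n x b => ampAverage F b.2 (fun _ => b.1) k φ (symmMatrix x)
  have hy : ∀ n, Measurable (y n) := fun n => (hu0 n).prodMk (hZ n)
  have hg : ∀ n, Measurable fun ω => upperEntries (G n ω) := fun n =>
    measurable_upperEntries.comp (hG n).measurable
  have hf : ∀ n, Measurable (Function.uncurry (f n)) := fun n =>
    measurable_ampAverage (k := k) hF hφ (measurable_symmMatrix.comp measurable_fst)
      (measurable_snd.comp measurable_snd) (measurable_fst.comp measurable_snd)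
  have hlaw : ∀ n, (P n).map (fun ω => (upperEntries (G n ω), y n ω)) =
      (stdGaussian _).prod ((P n).map (y n)) := fun n => (hG n).map_prod (hy n) (hindep n)
  -- Symmetry of `G` lets it be recovered from its upper entries, whose joint law with `(u^0, Z)` is
  -- a product.
  have hrA : ∀ n, randomAverage F k φ (u0 n) (Z n) (G n) =
      fun ω => f n (upperEntries (G n ω)) (y n ω) := by
    intro n
    funext ω
    simp only [randomAverage, f, y, symmMatrix_upperEntries ((hG n).symm ω)]
  have hν : ∀ n, IsProbabilityMeasure ((P n).map (y n)) := fun n =>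
    Measure.isProbabilityMeasure_map (hy n).aemeasurable
  have hsize : ∀ n, 1 ≤ n → ∀ a : ENNReal, a ≠ ⊤ →
      ∫⁻ b, a * ENNReal.ofReal (initSize b.1 ^ 2 * perturbSize b.2 ^ (2 * k)) ∂((P n).map (y n)) ≤
        a * ENNReal.ofReal M := by
    intro n hn a ha
    rw [lintegral_const_mul' _ _ ha]
    gcongr
    refine (lintegral_map_le _ _).trans ?_
    exact lintegral_size_le hn (hu0 n) (hZ n) hσ (abs_nonneg C) ((hu0_norm n hn).trans hC)
      (fun i j => (hZ_entry n hn i j).trans hC) k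
  have hsq : ∀ n, 1 ≤ n → ∀ b, ∫⁻ x, ENNReal.ofReal (f n x b ^ 2) ∂(stdGaussian _) ≤
      ENNReal.ofReal K * ENNReal.ofReal (initSize b.1 ^ 2 * perturbSize b.2 ^ (2 * k)) :=
    fun n hn b => (hmom n hn b.1 b.2).1
  have hvar : ∀ n, 1 ≤ n → ∀ b, ∫⁻ p, ENNReal.ofReal ((f n p.1 b - f n p.2 b) ^ 2)
        ∂((stdGaussian _).prod (stdGaussian _)) ≤
      ENNReal.ofReal (K / n) * ENNReal.ofReal (initSize b.1 ^ 2 * perturbSize b.2 ^ (2 * k)) :=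
    fun n hn b => (hmom n hn b.1 b.2).2
  have hL2 : ∀ n, 1 ≤ n → MemLp (fun ω => f n (upperEntries (G n ω)) (y n ω)) 2 (P n) := by
    intro n hn
    have hf' : Measurable fun q : EuclideanSpace ℝ (UpperIndex n) ×
        ((Fin n → ℝ) × Matrix (Fin n) (Fin n) ℝ) => f n q.1 q.2 := hf n
    refine memLp_two_of_lintegral_sq_lt_top
      (hf'.comp ((hg n).prodMk (hy n))).aestronglyMeasurable ?_
    have hF2 : Measurable fun q : EuclideanSpace ℝ (UpperIndex n) ×
        ((Fin n → ℝ) × Matrix (Fin n) (Fin n) ℝ) => ENNReal.ofReal (f n q.1 q.2 ^ 2) := by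
      fun_prop
    rw [← lintegral_map hF2 ((hg n).prodMk (hy n)), hlaw, lintegral_prod_symm _ hF2.aemeasurable]
    refine (lintegral_mono (hsq n hn)).trans_lt ?_
    exact (hsize n hn _ ENNReal.ofReal_ne_top).trans_lt
      (ENNReal.mul_lt_top ENNReal.ofReal_lt_top ENNReal.ofReal_lt_top)
  refine ⟨fun n hn => by rw [hrA]; exact hL2 n hn, ?_⟩
  have hbound : ∀ n, 1 ≤ n → ∫ ω, |randomAverage F k φ (u0 n) (Z n) (G n) ω -
        ((P n)[randomAverage F k φ (u0 n) (Z n) (G n) |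
          MeasurableSpace.comap (fun ω => (u0 n ω, Z n ω)) inferInstance]) ω| ^ 2 ∂(P n) ≤
      K * M / n := by
    intro n hn
    rw [hrA]
    refine integral_sq_sub_condExp_le_of_map_eq_prod (hg n) (hy n) (hlaw n) (hf n) (hL2 n hn)
      (by positivity) ?_
    refine (lintegral_mono (hvar n hn)).trans
      ((hsize n hn _ ENNReal.ofReal_ne_top).trans_eq ?_)
    rw [← ENNReal.ofReal_mul (by positivity)]
    congr 1
    ring
  refine tendsto_of_tendsto_of_tendsto_of_le_of_le' tendsto_const_nhds
    (tendsto_const_div_atTop_nhds_zero_nat (K * M))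
    (Eventually.of_forall fun n => integral_nonneg fun ω => by positivity) ?_
  filter_upwards [eventually_ge_atTop 1] with n hn
  exact hbound n hn
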